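/- Let $I_0=[-1,1]$. A *(normalized) unimodal map* is an even $C^3$ map $f:I_0\to I_0$ with $f(0)=1$, strictly increasing on $[-1,0]$ and strictly decreasing on $[0,1]$, whose derivative vanishes at $0$ and nowhere else in $I_0$. Its critical point is *non-flat* if there are a real number $d>1$ and a $C^3$ local diffeomorphism $\phi$ at $0$ with $\phi(0)=0$ such that $f(t)=f(0)-|\phi(t)|^{d}$ for all $t$ near $0$. The map $f$ is *renormalizable* if there is an integer $p>1$ such that, writing $\lambda=f^p(0)$ and $J=[-|\lambda|,|\lambda|]$, we have $\lambda\neq0$, $f^p(J)\subseteq J$, the map $x\mapsto\lambda^{-1}f^p(\lambda x)$ is a normalized unimodal map, and the intervals $J,f(J),\dots,f^{p-1}(J)$ have pairwise disjoint interiors. For the smallest such $p=p(f)$, put $Rf(x)=\lambda^{-1}f^{p}(\lambda x)$. The map $f$ is *infinitely renormalizable* if $R^nf$ is defined and renormalizable for every $n\ge0$. In that case put $a_n=p(R^nf)$, $q_n=a_0a_1\cdots a_{n-1}$ (so $q_0=1$), $\lambda_n=f^{q_n}(0)$ (so $\lambda_0=f(0)=1$), and $\Delta_{0,n}=[-|\lambda_n|,|\lambda_n|]$,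 and write $|\Delta|$ for the length of an interval $\Delta$. The map $f$ is *of bounded type* if $\sup_n a_n<\infty$. **Lemma.** Let $f$ be an infinitely renormalizable unimodal map with non-flat critical point, and let $\mu$ be the unique $f$-invariant Borel probability measure supported in the closure of the orbit $\{f^k(0):k\ge0\}$ of the critical point. Then there is a constant $C=C(f)>1$ such that $$\frac1C\sum_{n\ge0}\frac1{q_{n+1}}\log\frac{|\Delta_{0,n}|}{|\Delta_{0,n+1}|}\;\le\;\int_{I_0}\bigl|\log|Df|\bigr|\,d\mu\;\le\;C\sum_{n\ge0}\frac1{q_n}\log\frac{|\Delta_{0,n}|}{|\Delta_{0,n+1}|},$$ where the sums and the integral are taken in $[0,+\infty]$. Moreover, if $f$ is of bounded type, then the series on the right-hand side converges, and therefore $\log|Df|$ is $\mu$-integrable. -/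

import Mathlib

open Set MeasureTheory

namespace Unimodal

/-- The base interval `[-1, 1]`. -/
abbrev I₀ : Set ℝ := Icc (-1) 1

/-- `f` restricts to a normalized, even, `C³` unimodal map of `[-1, 1]` into itself: its only
critical point is `0`, its critical value is `1`. Only the values of `f` on `[-1, 1]` matter;
`derivWithin f I₀` is the derivative of the map `f : [-1, 1] → [-1, 1]` (one-sided at `±1`). -/
structure IsUnimodal (f : ℝ → ℝ) : Prop where
  contDiffOn : ContDiffOn ℝ 3 f I₀
  mapsTo : MapsTo f I₀ I₀
  even : ∀ x ∈ I₀, f (-x) = f x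
  map_zero : f 0 = 1
  strictMonoOn : StrictMonoOn f (Icc (-1) 0)
  strictAntiOn : StrictAntiOn f (Icc 0 1)
  deriv_eq_zero_iff : ∀ x ∈ I₀, derivWithin f I₀ x = 0 ↔ x = 0

/-- The turning point `0` is non-flat: near `0` we have `f(t) = f(0) - |φ(t)|^d` for some real
`d > 1` and some `C³` local diffeomorphism `φ` with `φ(0) = 0`. -/
def NonFlat (f : ℝ → ℝ) : Prop :=
  ∃ d : ℝ, 1 < d ∧ ∃ φ : ℝ → ℝ, ContDiffAt ℝ 3 φ 0 ∧ φ 0 = 0 ∧ deriv φ 0 ≠ 0 ∧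
    ∀ᶠ t in nhds (0 : ℝ), f t = f 0 - |φ t| ^ d

/-- The symmetric interval `[-|f^p(0)|, |f^p(0)|]`. -/
def symmInterval (f : ℝ → ℝ) (p : ℕ) : Set ℝ := Icc (-|f^[p] 0|) |f^[p] 0|

/-- The map `x ↦ λ⁻¹ f^p(λ x)` with `λ = f^p(0)`. -/
noncomputable def rescale (f : ℝ → ℝ) (p : ℕ) : ℝ → ℝ :=
  fun x => (f^[p] 0)⁻¹ * f^[p] (f^[p] 0 * x)

/-- `p > 1` is a period for which `f` can be renormalized: with `λ = f^p(0) ≠ 0` and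
`J = [-|λ|, |λ|]`, the map `f^p` sends `J` into `J` and is unimodal there (both are expressed, after
the linear change of scale `x ↦ λ x`, by `IsUnimodal (rescale f p)`), and the intervals
`J, f(J), …, f^(p-1)(J)` have pairwise disjoint interiors. -/
structure IsRenormalizationPeriod (f : ℝ → ℝ) (p : ℕ) : Prop where
  one_lt : 1 < p
  scale_ne_zero : f^[p] 0 ≠ 0
  unimodal : IsUnimodal (rescale f p)
  disjoint : ∀ i < p, ∀ j < p, i ≠ j →
    Disjoint (interior (f^[i] '' symmInterval f p)) (interior (f^[j] '' symmInterval f p))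

def Renormalizable (f : ℝ → ℝ) : Prop := ∃ p, IsRenormalizationPeriod f p

/-- The smallest renormalization period `p(f)` of a renormalizable map. -/
noncomputable def period (f : ℝ → ℝ) : ℕ := sInf {p | IsRenormalizationPeriod f p}

/-- The first renormalization `R f`. -/
noncomputable def renorm (f : ℝ → ℝ) : ℝ → ℝ := rescale f (period f)

/-- All the renormalizations `f, R f, R² f, …` are defined. -/
def InfinitelyRenormalizable (f : ℝ → ℝ) : Prop :=
  IsUnimodal f ∧ ∀ n : ℕ, Renormalizable (renorm^[n] f)

/-- The renormalization periods `a_n = p(Rⁿ f)`. -/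
noncomputable def renormPeriod (f : ℝ → ℝ) (n : ℕ) : ℕ := period (renorm^[n] f)

/-- The closest return times `q_n = a_0 a_1 ⋯ a_(n-1)`. -/
noncomputable def returnTime (f : ℝ → ℝ) (n : ℕ) : ℕ := ∏ i ∈ Finset.range n, renormPeriod f i

/-- The central renormalization interval `Δ_{0,n} = [-|λ_n|, |λ_n|]`, where `λ_n = f^{q_n}(0)`. -/
noncomputable def centralInterval (f : ℝ → ℝ) (n : ℕ) : Set ℝ := symmInterval f (returnTime f n)

/-- `log (|Δ_{0,n}| / |Δ_{0,n+1}|)`, with `|·|` the length of an interval. -/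
noncomputable def logRatio (f : ℝ → ℝ) (n : ℕ) : ℝ :=
  Real.log (volume.real (centralInterval f n) / volume.real (centralInterval f (n + 1)))

/-- The function `log |Df|` on `[-1, 1]` (its value at the critical point is immaterial, since an
invariant measure on the postcritical set has no atoms). -/
noncomputable def logAbsDeriv (f : ℝ → ℝ) (x : ℝ) : ℝ := Real.log |derivWithin f I₀ x|

/-- The combinatorics of `f` is of bounded type. -/
def BoundedType (f : ℝ → ℝ) : Prop := ∃ B : ℕ, ∀ n, renormPeriod f n ≤ B

/-- The closure of the orbit of the critical point. -/
def postcriticalSet (f : ℝ → ℝ) : Set ℝ := closure (range fun k : ℕ => f^[k] 0)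

/-- `μ` is an `f`-invariant Borel probability measure supported in the postcritical set. (As
`μ ≠ 0`, the equation `μ.map f = μ` contains the almost everywhere measurability of `f`; this is
automatic when `f` is continuous on `[-1, 1]` and `μ` lives on a subset of `[-1, 1]`.) -/
structure IsPostcriticalMeasure (f : ℝ → ℝ) (μ : Measure ℝ) : Prop where
  isProbabilityMeasure : IsProbabilityMeasure μ
  invariant : μ.map f = μ
  supported : μ (postcriticalSet f)ᶜ = 0

end Unimodal

/-!
Write `A_i = f^i(Δ_{0,n})`, `0 ≤ i < q_n`, for the cycle of intervals of level `n`, and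
`ℓ_n = log (|Δ_{0,n}| / |Δ_{0,n+1}|)`, so that `ℓ_0 + ⋯ + ℓ_{n-1} = log (1 / |λ_n|)`. Distinct
intervals of a cycle share at most one point (`IsCycle.mul`, by induction on the level). Hence every
invariant probability measure `μ` on the postcritical set gives each of them a mass between `1 / q_n`
and `2 / q_n` (`IsPostcriticalMeasure.inv_le_measure`, `IsPostcriticalMeasure.measure_le_two_div`);
in particular the critical point has mass zero. Non-flatness gives `|Df(x)| ≍ |x|^α` on `[-1, 1]`,
with `α = d - 1` (`NonFlat.exists_derivWithin_bounds`).

*Upper bound.* Up to an additive constant, `|log |Df(x)||` is at most `α log (1 / |x|)`, and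
`log (1 / |x|)` is at most the sum of the `ℓ_n` over the levels `n` with `x ∈ Δ_{0,n}`, for
`μ`-almost every `x`. Integrating gives `∑ 2 ℓ_n / q_n`. The additive constant is absorbed
by the term `ℓ_0 > 0` (`InfinitelyRenormalizable.exists_lintegral_le`).

*Lower bound.* The series `∑ ℓ_n / q_{n+1}` converges for every `f`
(`InfinitelyRenormalizable.summable_logRatio_div`). Indeed a renormalization `g` satisfies
`g(1) ≤ 0` (`IsRenormalizationPeriod.map_one_nonpos`), so `f^{q_n}` does not contract the pair
`{0, λ_n}`. On the other hand, the distance between its two points is multiplied by at most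
`c |λ_k|^α` each time they visit `Δ_{0,k}`, which happens `q_n / q_k` times. Comparing the two bounds, and cancelling
`log |λ_n|`, leaves `∑_{k<n} ℓ_k / q_{k+1} ≤ log c / α`. Since the series is finite, it suffices
that the integral is bounded below by a positive constant independent of `μ`. This holds as soon as
`|Df| ≠ 1` on a single interval of some cycle, because its mass is at least `1 / q_n`. Such an
interval exists by a distortion argument that needs no control of the size of the `A_i`
(`InfinitelyRenormalizable.exists_orbitInterval_abs_derivWithin_ne_one`).

*Bounded type.* If `q_{n+1} ≤ B q_n` for all `n`, then `∑ ℓ_n / q_n ≤ B ∑ ℓ_n / q_{n+1} < ∞`.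
-/

namespace Unimodal

/-! ### Cycles of intervals -/

/-- The `i`-th interval `f^i(J)` of the cycle generated by `J = [-|f^q(0)|, |f^q(0)|]`. -/
def orbitInterval (f : ℝ → ℝ) (q i : ℕ) : Set ℝ := f^[i] '' symmInterval f q

/-- A (not necessarily minimal) renormalization cycle of length `q`; the trivial cycle `q = 1` is
allowed. Compared with `IsRenormalizationPeriod`, disjointness of interiors is replaced by the
condition that two distinct intervals share at most one point. This is the same for intervals, and
is inherited by preimages under injective maps without any topology. -/
structure IsCycle (f : ℝ → ℝ) (q : ℕ) : Prop where
  pos : 0 < q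
  scale_ne_zero : f^[q] 0 ≠ 0
  unimodal : IsUnimodal (rescale f q)
  subsingleton : ∀ i < q, ∀ j < q, i ≠ j →
    (orbitInterval f q i ∩ orbitInterval f q j).Subsingleton

lemma mem_symmInterval {f : ℝ → ℝ} {q : ℕ} {x : ℝ} :
    x ∈ symmInterval f q ↔ |x| ≤ |f^[q] 0| := by
  rw [symmInterval, mem_Icc, abs_le]

lemma zero_mem_symmInterval (f : ℝ → ℝ) (q : ℕ) : (0 : ℝ) ∈ symmInterval f q := by
  rw [mem_symmInterval, abs_zero]; exact abs_nonneg _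

lemma orbitInterval_zero (f : ℝ → ℝ) (q : ℕ) : orbitInterval f q 0 = symmInterval f q := by
  simp [orbitInterval]

lemma mem_I₀ {x : ℝ} : x ∈ I₀ ↔ |x| ≤ 1 := by rw [mem_Icc, abs_le]

lemma image_orbitInterval (f : ℝ → ℝ) (q i j : ℕ) :
    f^[j] '' orbitInterval f q i = orbitInterval f q (j + i) := by
  rw [orbitInterval, orbitInterval, ← image_comp, Function.iterate_add]

namespace IsUnimodal

variable {f : ℝ → ℝ}

lemma continuousOn (hf : IsUnimodal f) : ContinuousOn f I₀ := hf.contDiffOn.continuousOn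

lemma mapsTo_iterate (hf : IsUnimodal f) (n : ℕ) : MapsTo f^[n] I₀ I₀ := hf.mapsTo.iterate n

lemma continuousOn_iterate (hf : IsUnimodal f) (n : ℕ) : ContinuousOn f^[n] I₀ :=
  hf.continuousOn.iterate hf.mapsTo n

lemma iterate_zero_mem (hf : IsUnimodal f) (n : ℕ) : f^[n] 0 ∈ I₀ :=
  hf.mapsTo_iterate n (by simp)

lemma symmInterval_subset (hf : IsUnimodal f) (q : ℕ) : symmInterval f q ⊆ I₀ := by
  intro x hx
  rw [mem_symmInterval] at hx
  exact mem_I₀.2 (hx.trans (mem_I₀.1 (hf.iterate_zero_mem q)))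

lemma orbitInterval_subset (hf : IsUnimodal f) (q i : ℕ) : orbitInterval f q i ⊆ I₀ :=
  ((hf.mapsTo_iterate i).mono_left (hf.symmInterval_subset q)).image_subset

lemma isConnected_orbitInterval (hf : IsUnimodal f) (q i : ℕ) :
    IsConnected (orbitInterval f q i) :=
  (isConnected_Icc (by linarith [abs_nonneg (f^[q] 0)])).image _
    ((hf.continuousOn_iterate i).mono (hf.symmInterval_subset q))

lemma isCompact_orbitInterval (hf : IsUnimodal f) (q i : ℕ) :
    IsCompact (orbitInterval f q i) :=
  isCompact_Icc.image_of_continuousOn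
    ((hf.continuousOn_iterate i).mono (hf.symmInterval_subset q))

lemma ordConnected_orbitInterval (hf : IsUnimodal f) (q i : ℕ) :
    OrdConnected (orbitInterval f q i) :=
  (hf.isConnected_orbitInterval q i).isPreconnected.ordConnected

/-- The only coincidences `f x = f y` are the forced ones `y = ± x`. -/
lemma abs_eq_of_eq (hf : IsUnimodal f) {x y : ℝ} (hx : x ∈ I₀) (hy : y ∈ I₀) (h : f x = f y) :
    |x| = |y| := by
  have habs : ∀ z ∈ I₀, f |z| = f z := by
    intro z hz
    rcases abs_choice z with h | h <;> rw [h]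
    exact hf.even z hz
  refine hf.strictAntiOn.injOn ⟨abs_nonneg _, mem_I₀.1 hx⟩ ⟨abs_nonneg _, mem_I₀.1 hy⟩ ?_
  rw [habs x hx, habs y hy, h]

lemma eq_of_abs_eq (hf : IsUnimodal f) {x y : ℝ} (hx : x ∈ I₀) (h : |x| = |y|) :
    f x = f y := by
  rcases abs_eq_abs.1 h with rfl | rfl
  · rfl
  · rw [← hf.even _ hx, neg_neg]

end IsUnimodal

lemma subsingleton_of_disjoint_interior {s t : Set ℝ} (hs : OrdConnected s) (ht : OrdConnected t)
    (h : Disjoint (interior s) (interior t)) : (s ∩ t).Subsingleton := by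
  have key : ∀ x ∈ s ∩ t, ∀ y ∈ s ∩ t, ¬ x < y := by
    intro x hx y hy hxy
    have h1 : Icc x y ⊆ s ∩ t := (hs.inter ht).out hx hy
    have h2 : Ioo x y ⊆ interior (s ∩ t) :=
      interior_maximal (Ioo_subset_Icc_self.trans h1) isOpen_Ioo
    rw [interior_inter, h.inter_eq] at h2
    obtain ⟨z, hz⟩ := exists_between hxy
    exact h2 hz
  intro x hx y hy
  exact le_antisymm (not_lt.1 (key y hy x hx)) (not_lt.1 (key x hx y hy))

lemma IsRenormalizationPeriod.isCycle {f : ℝ → ℝ} {p : ℕ} (h : IsRenormalizationPeriod f p)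
    (hf : IsUnimodal f) : IsCycle f p where
  pos := zero_lt_one.trans h.one_lt
  scale_ne_zero := h.scale_ne_zero
  unimodal := h.unimodal
  subsingleton i hi j hj hij := subsingleton_of_disjoint_interior
    (hf.ordConnected_orbitInterval p i) (hf.ordConnected_orbitInterval p j) (h.disjoint i hi j hj hij)

lemma rescale_one {f : ℝ → ℝ} (hf : IsUnimodal f) : rescale f 1 = f := by
  funext x
  simp [rescale, hf.map_zero]

lemma IsUnimodal.isCycle_one {f : ℝ → ℝ} (hf : IsUnimodal f) : IsCycle f 1 where
  pos := one_pos
  scale_ne_zero := by simp [hf.map_zero]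
  unimodal := by rwa [rescale_one hf]
  subsingleton i hi j hj hij := by omega

section Rescale

variable {f : ℝ → ℝ} {q : ℕ}

/-- Linear conjugacy between the iterates of a rescaled return map and those of `f`. -/
lemma mul_iterate_rescale (h : f^[q] 0 ≠ 0) (s : ℕ) (x : ℝ) :
    f^[q] 0 * (rescale f q)^[s] x = f^[q * s] (f^[q] 0 * x) := by
  have hs : Function.Semiconj (fun x => f^[q] 0 * x) (rescale f q) f^[q] := by
    intro x
    simp only [rescale]
    field_simp
  rw [Function.iterate_mul]
  exact (hs.iterate_right s) x

lemma mul_iterate_rescale_zero (h : f^[q] 0 ≠ 0) (s : ℕ) :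
    f^[q] 0 * (rescale f q)^[s] 0 = f^[q * s] 0 := by
  rw [mul_iterate_rescale h, mul_zero]

lemma rescale_rescale (h : f^[q] 0 ≠ 0) (p : ℕ) :
    rescale (rescale f q) p = rescale f (q * p) := by
  funext x
  have h1 : (rescale f q)^[p] 0 = (f^[q] 0)⁻¹ * f^[q * p] 0 := by
    rw [← mul_iterate_rescale_zero h, inv_mul_cancel_left₀ h]
  have h2 : ∀ y, (rescale f q)^[p] y = (f^[q] 0)⁻¹ * f^[q * p] (f^[q] 0 * y) := by
    intro y
    rw [← mul_iterate_rescale h, inv_mul_cancel_left₀ h]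
  rw [rescale, h1, h2, rescale, ← mul_assoc (f^[q] 0), mul_inv_cancel_left₀ h]
  field_simp

lemma symmInterval_mul (h : f^[q] 0 ≠ 0) (p : ℕ) :
    symmInterval f (q * p) = (fun x => f^[q] 0 * x) '' symmInterval (rescale f q) p := by
  ext x
  simp only [mem_image, mem_symmInterval]
  rw [← mul_iterate_rescale_zero h, abs_mul]
  have h0 : 0 < |f^[q] 0| := abs_pos.2 h
  constructor
  · intro hx
    refine ⟨(f^[q] 0)⁻¹ * x, ?_, mul_inv_cancel_left₀ h x⟩
    rw [abs_mul, abs_inv]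
    rwa [inv_mul_le_iff₀ h0]
  · rintro ⟨y, hy, rfl⟩
    rw [abs_mul]
    gcongr

lemma orbitInterval_mul (h : f^[q] 0 ≠ 0) (p s : ℕ) :
    orbitInterval f (q * p) (q * s) =
      (fun x => f^[q] 0 * x) '' orbitInterval (rescale f q) p s := by
  rw [orbitInterval, orbitInterval, symmInterval_mul h, ← image_comp, ← image_comp]
  congr 1
  funext x
  exact (mul_iterate_rescale h s x).symm

lemma mem_symmInterval_iff_exists (h : f^[q] 0 ≠ 0) {x : ℝ} :
    x ∈ symmInterval f q ↔ ∃ y ∈ I₀, f^[q] 0 * y = x := by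
  have h0 : 0 < |f^[q] 0| := abs_pos.2 h
  simp only [mem_symmInterval, mem_I₀]
  constructor
  · intro hx
    refine ⟨(f^[q] 0)⁻¹ * x, ?_, mul_inv_cancel_left₀ h x⟩
    rwa [abs_mul, abs_inv, inv_mul_le_iff₀ h0, mul_one]
  · rintro ⟨y, hy, rfl⟩
    rw [abs_mul]
    nlinarith

namespace IsCycle

lemma mapsTo_iterate (hc : IsCycle f q) (s : ℕ) :
    MapsTo f^[q * s] (symmInterval f q) (symmInterval f q) := by
  intro x hx
  obtain ⟨y, hy, rfl⟩ := (mem_symmInterval_iff_exists hc.scale_ne_zero).1 hx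
  rw [← mul_iterate_rescale hc.scale_ne_zero]
  exact (mem_symmInterval_iff_exists hc.scale_ne_zero).2 ⟨_, hc.unimodal.mapsTo_iterate s hy, rfl⟩

/-- The return map `f^q` is even and injective on each half of the central interval. -/
lemma abs_eq_of_iterate_eq (hc : IsCycle f q) {x y : ℝ} (hx : x ∈ symmInterval f q)
    (hy : y ∈ symmInterval f q) (h : f^[q] x = f^[q] y) : |x| = |y| := by
  obtain ⟨u, hu, rfl⟩ := (mem_symmInterval_iff_exists hc.scale_ne_zero).1 hx
  obtain ⟨v, hv, rfl⟩ := (mem_symmInterval_iff_exists hc.scale_ne_zero).1 hy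
  rw [abs_mul, abs_mul, hc.unimodal.abs_eq_of_eq hu hv (congrArg (fun z => (f^[q] 0)⁻¹ * z) h)]

lemma symmInterval_mul_subset {p : ℕ} (hc : IsCycle f q) (s : ℕ) :
    orbitInterval f (q * p) (q * s) ⊆ symmInterval f q := by
  rw [orbitInterval_mul hc.scale_ne_zero]
  rintro _ ⟨y, hy, rfl⟩
  exact (mem_symmInterval_iff_exists hc.scale_ne_zero).2
    ⟨y, hc.unimodal.orbitInterval_subset p s hy, rfl⟩

/-- The intervals `f(J), …, f^q(J)` are almost disjoint too, since `f^q(J) ⊆ J`. -/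
lemma subsingleton_le (hc : IsCycle f q) {i j : ℕ} (hi : 0 < i) (hij : i < j) (hj : j ≤ q) :
    (orbitInterval f q i ∩ orbitInterval f q j).Subsingleton := by
  rcases hj.lt_or_eq with h | rfl
  · exact hc.subsingleton i (hij.trans h) j h hij.ne
  · refine (hc.subsingleton i hij 0 hc.pos hi.ne').anti (inter_subset_inter_right _ ?_)
    rw [orbitInterval_zero]
    have := (hc.mapsTo_iterate 1).image_subset
    rwa [mul_one] at this

/-- A cycle of the return map of a cycle is a cycle of the original map. Two of its intervals that
lie in the same interval `f^r(J)` of the coarse cycle are compared at the next return to `J`. -/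
lemma mul (hf : IsUnimodal f) (hc : IsCycle f q) {p : ℕ} (hp : IsCycle (rescale f q) p) :
    IsCycle f (q * p) where
  pos := Nat.mul_pos hc.pos hp.pos
  scale_ne_zero := by
    rw [← mul_iterate_rescale_zero hc.scale_ne_zero]
    exact mul_ne_zero hc.scale_ne_zero hp.scale_ne_zero
  unimodal := by
    rw [← rescale_rescale hc.scale_ne_zero]
    exact hp.unimodal
  subsingleton := by
    have h0 := hc.scale_ne_zero
    have hsub : ∀ i, orbitInterval f (q * p) i ⊆ orbitInterval f q (i % q) := by
      intro i
      conv_lhs => rw [← Nat.mod_add_div i q]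
      rw [← image_orbitInterval, orbitInterval]
      exact image_mono (hc.symmInterval_mul_subset _)
    -- almost disjointness for times that are multiples of `q`
    have hscale : ∀ s t, (orbitInterval (rescale f q) p s ∩
        orbitInterval (rescale f q) p t).Subsingleton →
        (orbitInterval f (q * p) (q * s) ∩ orbitInterval f (q * p) (q * t)).Subsingleton := by
      intro s t h
      rw [orbitInterval_mul h0, orbitInterval_mul h0, ← image_inter (mul_right_injective₀ h0)]
      exact h.image _
    have main : ∀ i < q * p, ∀ j < q * p, i < j →
        (orbitInterval f (q * p) i ∩ orbitInterval f (q * p) j).Subsingleton := by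
      intro i hi j hj hij
      by_cases hr : i % q = j % q
      · have hi' : i / q < p := Nat.div_lt_of_lt_mul hi
        have hj' : j / q < p := Nat.div_lt_of_lt_mul hj
        have hd : i / q < j / q := by
          have h1 := Nat.mod_add_div i q
          have h2 := Nat.mod_add_div j q
          by_contra hcon
          have := Nat.mul_le_mul_left q (not_lt.1 hcon)
          omega
        rcases Nat.eq_zero_or_pos (i % q) with hr0 | hr0
        · have h1 := Nat.mod_add_div i q
          have h2 := Nat.mod_add_div j q
          rw [← h1, ← h2, ← hr, hr0, zero_add, zero_add]
          exact hscale _ _ (hp.subsingleton _ hi' _ hj' hd.ne)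
        · -- with `r = i % q > 0`, the map `f^(q - r)` is injective on `f^r(J)`, because `f^q` is
          -- unimodal on `J`; it carries the pair to almost disjoint intervals
          have hS := hscale _ _ (hp.subsingleton_le (Nat.succ_pos (i / q))
            (Nat.succ_lt_succ hd) hj')
          have hmem : ∀ k, ∀ a ∈ orbitInterval f (q * p) (q * k),
              f^[q] a ∈ orbitInterval f (q * p) (q * (k + 1)) := by
            intro k a ha
            rw [mul_add, mul_one, add_comm, ← image_orbitInterval]
            exact mem_image_of_mem _ ha
          have hlt := Nat.mod_lt i hc.pos
          have hret : ∀ a b, f^[i % q] a = f^[i % q] b → f^[q] a = f^[q] b := by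
            intro a b hab
            rw [← Nat.sub_add_cancel hlt.le, Function.iterate_add_apply, hab,
              ← Function.iterate_add_apply]
          rintro x ⟨hxi, hxj⟩ y ⟨hyi, hyj⟩
          rw [← Nat.mod_add_div i q, ← image_orbitInterval] at hxi hyi
          rw [← Nat.mod_add_div j q, ← image_orbitInterval, ← hr] at hxj hyj
          obtain ⟨a, ha, rfl⟩ := hxi
          obtain ⟨b, hb, hab⟩ := hxj
          obtain ⟨a', ha', rfl⟩ := hyi
          obtain ⟨b', hb', hab'⟩ := hyj
          have hq : f^[q] a = f^[q] a' := by
            refine hS ⟨hmem _ a ha, ?_⟩ ⟨hmem _ a' ha', ?_⟩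
            · rw [hret a b hab.symm]; exact hmem _ b hb
            · rw [hret a' b' hab'.symm]; exact hmem _ b' hb'
          have haJ := hc.symmInterval_mul_subset _ ha
          have hfa : f a = f a' := hf.eq_of_abs_eq (hf.symmInterval_subset q haJ)
            (hc.abs_eq_of_iterate_eq haJ (hc.symmInterval_mul_subset _ ha') hq)
          rw [← Nat.succ_pred_eq_of_pos hr0, Function.iterate_succ_apply, hfa,
            Function.iterate_succ_apply]
      · exact (hc.subsingleton _ (Nat.mod_lt i hc.pos) _ (Nat.mod_lt j hc.pos) hr).anti
          (inter_subset_inter (hsub i) (hsub j))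
    intro i hi j hj hij
    rcases hij.lt_or_gt with h | h
    · exact main i hi j hj h
    · rw [inter_comm]
      exact main j hj i hi h

end IsCycle

end Rescale

/-! ### The cycles of an infinitely renormalizable map -/

section Tower

variable {f : ℝ → ℝ}

lemma returnTime_zero (f : ℝ → ℝ) : returnTime f 0 = 1 := by simp [returnTime]

lemma returnTime_succ (f : ℝ → ℝ) (n : ℕ) :
    returnTime f (n + 1) = returnTime f n * renormPeriod f n := by
  simp [returnTime, Finset.prod_range_succ]

lemma InfinitelyRenormalizable.isRenormalizationPeriod (hf : InfinitelyRenormalizable f) (n : ℕ) :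
    IsRenormalizationPeriod (renorm^[n] f) (renormPeriod f n) :=
  Nat.sInf_mem (hf.2 n)

lemma InfinitelyRenormalizable.isUnimodal_renorm (hf : InfinitelyRenormalizable f) (n : ℕ) :
    IsUnimodal (renorm^[n] f) := by
  cases n with
  | zero => exact hf.1
  | succ n =>
    rw [Function.iterate_succ_apply']
    exact (hf.isRenormalizationPeriod n).unimodal

lemma InfinitelyRenormalizable.isCycle_and_renorm_eq (hf : InfinitelyRenormalizable f) (n : ℕ) :
    IsCycle f (returnTime f n) ∧ renorm^[n] f = rescale f (returnTime f n) := by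
  induction n with
  | zero => exact ⟨by rw [returnTime_zero]; exact hf.1.isCycle_one,
      by rw [returnTime_zero, rescale_one hf.1]; rfl⟩
  | succ n ih =>
    have h := hf.isRenormalizationPeriod n
    have hc := h.isCycle (hf.isUnimodal_renorm n)
    rw [ih.2] at hc
    rw [returnTime_succ]
    refine ⟨ih.1.mul hf.1 hc, ?_⟩
    rw [← rescale_rescale ih.1.scale_ne_zero, Function.iterate_succ_apply', ← ih.2]
    rfl

lemma InfinitelyRenormalizable.isCycle (hf : InfinitelyRenormalizable f) (n : ℕ) :
    IsCycle f (returnTime f n) := (hf.isCycle_and_renorm_eq n).1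

lemma InfinitelyRenormalizable.isRenormalizationPeriod_rescale (hf : InfinitelyRenormalizable f)
    (n : ℕ) : IsRenormalizationPeriod (rescale f (returnTime f n)) (renormPeriod f n) := by
  rw [← (hf.isCycle_and_renorm_eq n).2]
  exact hf.isRenormalizationPeriod n

lemma InfinitelyRenormalizable.two_pow_le_returnTime (hf : InfinitelyRenormalizable f) (n : ℕ) :
    2 ^ n ≤ returnTime f n := by
  induction n with
  | zero => rw [returnTime_zero, pow_zero]
  | succ n ih =>
    rw [returnTime_succ, pow_succ]
    exact Nat.mul_le_mul ih (hf.isRenormalizationPeriod n).one_lt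

lemma returnTime_dvd (f : ℝ → ℝ) {m n : ℕ} (h : m ≤ n) : returnTime f m ∣ returnTime f n :=
  Finset.prod_dvd_prod_of_subset _ _ _ (Finset.range_mono h)

/-- If `q_m` divides `i`, the `i`-th interval of every deeper cycle lies in `Δ_{0,m}`. -/
lemma InfinitelyRenormalizable.orbitInterval_subset_centralInterval
    (hf : InfinitelyRenormalizable f) {m n i : ℕ} (h : m ≤ n) (hi : returnTime f m ∣ i) :
    orbitInterval f (returnTime f n) i ⊆ centralInterval f m := by
  obtain ⟨p, hp⟩ := returnTime_dvd f h
  obtain ⟨s, rfl⟩ := hi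
  rw [hp]
  exact (hf.isCycle m).symmInterval_mul_subset s

lemma InfinitelyRenormalizable.centralInterval_anti (hf : InfinitelyRenormalizable f) :
    Antitone (centralInterval f) := by
  intro m n h
  have := hf.orbitInterval_subset_centralInterval h (dvd_zero (returnTime f m))
  rwa [orbitInterval_zero] at this

lemma mem_centralInterval {n : ℕ} {x : ℝ} :
    x ∈ centralInterval f n ↔ |x| ≤ |f^[returnTime f n] 0| := mem_symmInterval

lemma InfinitelyRenormalizable.abs_scale_anti (hf : InfinitelyRenormalizable f) :
    Antitone fun n => |f^[returnTime f n] 0| := by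
  intro m n h
  exact mem_centralInterval.1 (hf.centralInterval_anti h (mem_centralInterval.2 le_rfl))

lemma InfinitelyRenormalizable.abs_scale_pos (hf : InfinitelyRenormalizable f) (n : ℕ) :
    0 < |f^[returnTime f n] 0| := abs_pos.2 (hf.isCycle n).scale_ne_zero

lemma InfinitelyRenormalizable.abs_scale_zero (hf : InfinitelyRenormalizable f) :
    |f^[returnTime f 0] 0| = 1 := by
  simp [returnTime_zero, hf.1.map_zero]

lemma logRatio_eq (hf : InfinitelyRenormalizable f) (n : ℕ) :
    logRatio f n = Real.log |f^[returnTime f n] 0| - Real.log |f^[returnTime f (n + 1)] 0| := by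
  have hv : ∀ n, volume.real (centralInterval f n) = 2 * |f^[returnTime f n] 0| := by
    intro n
    rw [centralInterval, symmInterval,
      Real.volume_real_Icc_of_le (by linarith [abs_nonneg (f^[returnTime f n] 0)])]
    ring
  rw [logRatio, hv, hv, mul_div_mul_left _ _ two_ne_zero,
    Real.log_div (hf.abs_scale_pos n).ne' (hf.abs_scale_pos (n + 1)).ne']

lemma logRatio_nonneg (hf : InfinitelyRenormalizable f) (n : ℕ) : 0 ≤ logRatio f n := by
  rw [logRatio_eq hf, sub_nonneg]
  exact Real.log_le_log (hf.abs_scale_pos _) (hf.abs_scale_anti n.le_succ)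

lemma sum_logRatio (hf : InfinitelyRenormalizable f) (n : ℕ) :
    ∑ k ∈ Finset.range n, logRatio f k = -Real.log |f^[returnTime f n] 0| := by
  simp_rw [logRatio_eq hf]
  rw [Finset.sum_range_sub', hf.abs_scale_zero, Real.log_one, zero_sub]

/-- The central interval of a nontrivial cycle is a proper subinterval. -/
lemma logRatio_zero_pos (hf : InfinitelyRenormalizable f) : 0 < logRatio f 0 := by
  rw [logRatio_eq hf, hf.abs_scale_zero, Real.log_one, zero_sub, neg_pos]
  refine Real.log_neg (hf.abs_scale_pos 1) (lt_of_le_of_ne (mem_I₀.1 (hf.1.iterate_zero_mem _)) ?_)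
  intro h1
  have hq : 1 < returnTime f 1 := (hf.two_pow_le_returnTime 1).trans_lt' one_lt_two
  have hJ : symmInterval f (returnTime f 1) = I₀ := by
    rw [symmInterval, h1]
  have hsub := (hf.isCycle 1).subsingleton 1 hq 0 (hf.isCycle 1).pos one_ne_zero
  rw [orbitInterval_zero, hJ] at hsub
  have hmem : ∀ x ∈ I₀, f x ∈ orbitInterval f (returnTime f 1) 1 ∩ I₀ := fun x hx =>
    ⟨⟨x, by rwa [hJ], rfl⟩, hf.1.mapsTo hx⟩
  have h01 := hf.1.abs_eq_of_eq (x := 0) (y := 1) (by simp) (by simp)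
    (hsub (hmem 0 (by simp)) (hmem 1 (by simp)))
  simp at h01

end Tower

/-! ### Measures of the intervals of a cycle -/

section

variable {f : ℝ → ℝ} {q : ℕ}

lemma IsCycle.iterate_ne (hc : IsCycle f q) {i : ℕ} (hi : i ≤ q) :
    f^[i] 0 ≠ f^[i] (f^[q] 0) := by
  intro h
  have h1 : f^[q] 0 = f^[q] (f^[q] 0) := by
    have hq : ∀ x, f^[q] x = f^[q - i] (f^[i] x) := fun x => by
      rw [← Function.iterate_add_apply, Nat.sub_add_cancel hi]
    exact (hq 0).trans ((congrArg _ h).trans (hq _).symm)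
  have h2 := hc.abs_eq_of_iterate_eq (zero_mem_symmInterval f q) (mem_symmInterval.2 le_rfl) h1
  rw [abs_zero, eq_comm, abs_eq_zero] at h2
  exact hc.scale_ne_zero h2

lemma IsCycle.exists_eq_Icc (hc : IsCycle f q) (hf : IsUnimodal f) {i : ℕ} (hi : i < q) :
    ∃ a b, a < b ∧ orbitInterval f q i = Icc a b := by
  have h := eq_Icc_of_connected_compact (hf.isConnected_orbitInterval q i)
    (hf.isCompact_orbitInterval q i)
  refine ⟨_, _, ?_, h⟩
  by_contra hcon
  have hs : (orbitInterval f q i).Subsingleton := by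
    rw [h]; exact subsingleton_Icc_of_ge (not_lt.1 hcon)
  exact hc.iterate_ne hi.le (hs ⟨_, zero_mem_symmInterval f q, rfl⟩
    ⟨_, mem_symmInterval.2 le_rfl, rfl⟩)

/-- Each point lies in at most two intervals of a cycle: in at most one that continues to its
right, and in at most one that continues to its left. -/
lemma IsCycle.sum_measure_le (hc : IsCycle f q) (hf : IsUnimodal f) (ν : Measure ℝ) :
    ∑ i ∈ Finset.range q, ν (orbitInterval f q i) ≤ 2 * ν I₀ := by
  have h : ∀ i, ∃ a b, i < q → a < b ∧ orbitInterval f q i = Icc a b := by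
    intro i
    by_cases hi : i < q
    · obtain ⟨a, b, h⟩ := hc.exists_eq_Icc hf hi
      exact ⟨a, b, fun _ => h⟩
    · exact ⟨0, 0, fun h => absurd h hi⟩
  choose a b hab using h
  have key : ∀ t : ℕ → Set ℝ, (∀ i, MeasurableSet (t i)) → (∀ i, t i ⊆ Icc (a i) (b i)) →
      (∀ i < q, ∀ j < q, ∀ x ∈ t i, x ∈ t j →
        ∃ y, y ≠ x ∧ y ∈ Icc (a i) (b i) ∧ y ∈ Icc (a j) (b j)) →
      ∑ i ∈ Finset.range q, ν (t i) ≤ ν I₀ := by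
    intro t hm hsub ht
    rw [← measure_biUnion_finset _ fun i _ => hm i]
    · refine measure_mono (iUnion₂_subset fun i hi => (hsub i).trans ?_)
      rw [← (hab i (Finset.mem_range.1 hi)).2]
      exact hf.orbitInterval_subset q i
    · intro i hi j hj hij
      have hi' := Finset.mem_range.1 hi
      have hj' := Finset.mem_range.1 hj
      refine Set.disjoint_left.2 fun x hxi hxj => ?_
      obtain ⟨y, hne, hyi, hyj⟩ := ht i hi' j hj' x hxi hxj
      have hs := hc.subsingleton i hi' j hj' hij
      rw [(hab i hi').2, (hab j hj').2] at hs
      exact hne (hs ⟨hyi, hyj⟩ ⟨hsub i hxi, hsub j hxj⟩)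
  calc ∑ i ∈ Finset.range q, ν (orbitInterval f q i)
      ≤ ∑ i ∈ Finset.range q, (ν (Ico (a i) (b i)) + ν (Ioc (a i) (b i))) := by
        refine Finset.sum_le_sum fun i hi => ?_
        obtain ⟨hlt, he⟩ := hab i (Finset.mem_range.1 hi)
        rw [he]
        refine (measure_mono fun x hx => ?_).trans (measure_union_le _ _)
        rcases hx.2.lt_or_eq with h | h
        · exact Or.inl ⟨hx.1, h⟩
        · exact Or.inr ⟨h ▸ hlt, h.le⟩
    _ = ∑ i ∈ Finset.range q, ν (Ico (a i) (b i)) +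
          ∑ i ∈ Finset.range q, ν (Ioc (a i) (b i)) := Finset.sum_add_distrib
    _ ≤ ν I₀ + ν I₀ := by
        refine add_le_add (key _ (fun _ => measurableSet_Ico) (fun _ => Ico_subset_Icc_self) ?_)
          (key _ (fun _ => measurableSet_Ioc) (fun _ => Ioc_subset_Icc_self) ?_)
        · intro i _ j _ x hxi hxj
          have hx := lt_min hxi.2 hxj.2
          exact ⟨min (b i) (b j), hx.ne', ⟨hxi.1.trans hx.le, min_le_left _ _⟩,
            ⟨hxj.1.trans hx.le, min_le_right _ _⟩⟩
        · intro i _ j _ x hxi hxj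
          have hx := max_lt hxi.1 hxj.1
          exact ⟨max (a i) (a j), hx.ne, ⟨le_max_left _ _, hx.le.trans hxi.2⟩,
            ⟨le_max_right _ _, hx.le.trans hxj.2⟩⟩
    _ = 2 * ν I₀ := (two_mul _).symm

lemma IsCycle.sum_length_le (hc : IsCycle f q) (hf : IsUnimodal f) :
    ∑ i ∈ Finset.range q, volume.real (orbitInterval f q i) ≤ 4 := by
  have h := hc.sum_measure_le hf volume
  have hI : volume I₀ = 2 := by rw [Real.volume_Icc]; norm_num
  rw [hI] at h
  have h4 := ENNReal.toReal_mono (by norm_num) h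
  rw [ENNReal.toReal_sum fun i _ => (hf.isCompact_orbitInterval q i).measure_ne_top] at h4
  simp only [ENNReal.toReal_mul, ENNReal.toReal_ofNat] at h4
  calc _ ≤ (2 : ℝ) * 2 := h4
    _ = 4 := by norm_num

lemma IsCycle.postcriticalSet_subset (hc : IsCycle f q) (hf : IsUnimodal f) :
    postcriticalSet f ⊆ ⋃ i ∈ Finset.range q, orbitInterval f q i := by
  refine closure_minimal ?_ (isClosed_biUnion_finset fun i _ =>
    (hf.isCompact_orbitInterval q i).isClosed)
  rintro _ ⟨k, rfl⟩
  refine mem_iUnion₂.2 ⟨k % q, Finset.mem_range.2 (Nat.mod_lt k hc.pos), f^[q * (k / q)] 0,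
    hc.mapsTo_iterate _ (zero_mem_symmInterval f q), ?_⟩
  rw [← Function.iterate_add_apply, Nat.mod_add_div]

namespace IsPostcriticalMeasure

variable {μ : Measure ℝ}

lemma aemeasurable (hμ : IsPostcriticalMeasure f μ) : AEMeasurable f μ := by
  by_contra h
  have h1 := hμ.invariant
  rw [Measure.map_of_not_aemeasurable h] at h1
  have := hμ.isProbabilityMeasure
  exact IsProbabilityMeasure.ne_zero μ h1.symm

lemma measure_le_of_mapsTo (hμ : IsPostcriticalMeasure f μ) {s t : Set ℝ} (ht : MeasurableSet t)
    (h : MapsTo f s t) : μ s ≤ μ t := by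
  conv_rhs => rw [← hμ.invariant, Measure.map_apply_of_aemeasurable hμ.aemeasurable ht]
  exact measure_mono h

/-- By invariance all the intervals of a cycle have the same measure. -/
lemma measure_orbitInterval (hμ : IsPostcriticalMeasure f μ) (hf : IsUnimodal f)
    (hc : IsCycle f q) {i : ℕ} (hi : i < q) :
    μ (orbitInterval f q i) = μ (symmInterval f q) := by
  have hstep : ∀ i, μ (orbitInterval f q i) ≤ μ (orbitInterval f q (i + 1)) := by
    intro i
    refine hμ.measure_le_of_mapsTo (hf.isCompact_orbitInterval q (i + 1)).measurableSet ?_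
    intro x hx
    rw [add_comm, ← image_orbitInterval]
    exact mem_image_of_mem _ hx
  have hmono := monotone_nat_of_le_succ hstep
  have hq : orbitInterval f q q ⊆ symmInterval f q := by
    have := (hc.mapsTo_iterate 1).image_subset
    rwa [mul_one] at this
  refine le_antisymm ((hmono hi.le).trans (measure_mono hq)) ?_
  rw [← orbitInterval_zero]
  exact hmono (Nat.zero_le i)

lemma one_le_mul_measure (hμ : IsPostcriticalMeasure f μ) (hf : IsUnimodal f)
    (hc : IsCycle f q) : 1 ≤ q * μ (symmInterval f q) := by
  have := hμ.isProbabilityMeasure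
  have h1 : μ (⋃ i ∈ Finset.range q, orbitInterval f q i) = 1 := by
    rw [← prob_compl_eq_zero_iff]
    · exact measure_mono_null (compl_subset_compl.2 (hc.postcriticalSet_subset hf)) hμ.supported
    · exact Finset.measurableSet_biUnion _ fun i _ =>
        (hf.isCompact_orbitInterval q i).measurableSet
  rw [← h1]
  refine (measure_biUnion_finset_le _ _).trans ?_
  rw [Finset.sum_congr rfl fun i hi => hμ.measure_orbitInterval hf hc (Finset.mem_range.1 hi)]
  simp

lemma mul_measure_le_two (hμ : IsPostcriticalMeasure f μ) (hf : IsUnimodal f)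
    (hc : IsCycle f q) : q * μ (symmInterval f q) ≤ 2 := by
  have := hμ.isProbabilityMeasure
  have h := hc.sum_measure_le hf μ
  rw [Finset.sum_congr rfl fun i hi => hμ.measure_orbitInterval hf hc (Finset.mem_range.1 hi)] at h
  calc (q : ENNReal) * μ (symmInterval f q) ≤ 2 * μ I₀ := by simpa using h
    _ ≤ 2 * 1 := by gcongr; exact prob_le_one
    _ = 2 := mul_one 2

lemma inv_le_measure (hμ : IsPostcriticalMeasure f μ) (hf : IsUnimodal f)
    (hc : IsCycle f q) : (q : ENNReal)⁻¹ ≤ μ (symmInterval f q) := by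
  rw [ENNReal.inv_le_iff_le_mul (fun _ => by simpa using hc.pos.ne') (by simp)]
  exact hμ.one_le_mul_measure hf hc

lemma measure_le_two_div (hμ : IsPostcriticalMeasure f μ) (hf : IsUnimodal f)
    (hc : IsCycle f q) : μ (symmInterval f q) ≤ 2 / q := by
  rw [ENNReal.le_div_iff_mul_le (by simp [hc.pos.ne']) (by simp), mul_comm]
  exact hμ.mul_measure_le_two hf hc

lemma measure_iInter_centralInterval (hμ : IsPostcriticalMeasure f μ)
    (hf : InfinitelyRenormalizable f) : μ (⋂ n, centralInterval f n) = 0 := by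
  have h : ∀ n : ℕ, μ (⋂ n, centralInterval f n) ≤ 2 / (n : ENNReal) := by
    intro n
    calc μ (⋂ n, centralInterval f n) ≤ μ (centralInterval f n) :=
          measure_mono (iInter_subset _ n)
      _ ≤ 2 / (returnTime f n : ENNReal) := hμ.measure_le_two_div hf.1 (hf.isCycle n)
      _ ≤ 2 / (n : ENNReal) := by
          gcongr
          exact Nat.lt_two_pow_self.le.trans (hf.two_pow_le_returnTime n)
  have ht : Filter.Tendsto (fun n : ℕ => 2 / (n : ENNReal)) Filter.atTop (nhds 0) := by
    have := ENNReal.Tendsto.const_mul ENNReal.tendsto_inv_nat_nhds_zero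
      (Or.inr (ENNReal.ofNat_ne_top : (2 : ENNReal) ≠ ⊤))
    simpa [div_eq_mul_inv] using this
  exact le_antisymm (ge_of_tendsto' ht h) bot_le

lemma measure_zero (hμ : IsPostcriticalMeasure f μ) (hf : InfinitelyRenormalizable f) :
    μ {0} = 0 := by
  refine measure_mono_null ?_ (hμ.measure_iInter_centralInterval hf)
  rw [singleton_subset_iff]
  exact mem_iInter.2 fun n => zero_mem_symmInterval f _

end IsPostcriticalMeasure

end

/-! ### The size of the derivative near a non-flat critical point -/

section

open Filter Topology

variable {f : ℝ → ℝ}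

lemma uniqueDiffOn_I₀ : UniqueDiffOn ℝ I₀ := uniqueDiffOn_Icc (by norm_num)

lemma IsUnimodal.hasDerivWithinAt (hf : IsUnimodal f) {x : ℝ} (hx : x ∈ I₀) :
    HasDerivWithinAt f (derivWithin f I₀ x) I₀ x :=
  (hf.contDiffOn.differentiableOn (by norm_num) x hx).hasDerivWithinAt

lemma IsUnimodal.exists_lipschitzOnWith_derivWithin (hf : IsUnimodal f) :
    ∃ K, LipschitzOnWith K (derivWithin f I₀) I₀ :=
  (hf.contDiffOn.derivWithin (m := 2) uniqueDiffOn_I₀ (by norm_num)).exists_lipschitzOnWith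
    (by norm_num) (convex_Icc _ _) isCompact_Icc

lemma IsUnimodal.continuousOn_derivWithin (hf : IsUnimodal f) :
    ContinuousOn (derivWithin f I₀) I₀ :=
  hf.contDiffOn.continuousOn_derivWithin uniqueDiffOn_I₀ (by norm_num)

/-- Near a non-flat critical point of order `d`, the derivative is asymptotic to a multiple of
`|x|^(d - 1)`. -/
lemma NonFlat.exists_tendsto (h : NonFlat f) :
    ∃ α : ℝ, 0 < α ∧ ∃ l : ℝ, 0 < l ∧
      Tendsto (fun x => |derivWithin f I₀ x| / |x| ^ α) (𝓝[≠] 0) (𝓝 l) := by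
  obtain ⟨d, hd, φ, hφ, hφ0, hφ', he⟩ := h
  refine ⟨d - 1, by linarith, d * |deriv φ 0| ^ (d - 1) * |deriv φ 0|, by positivity, ?_⟩
  have hslope : Tendsto (slope φ 0) (𝓝[≠] 0) (𝓝 (deriv φ 0)) :=
    (hφ.differentiableAt (by norm_num)).hasDerivAt.tendsto_slope
  have hcont : Tendsto (deriv φ) (𝓝[≠] 0) (𝓝 (deriv φ 0)) := by
    have h1 : ContDiffAt ℝ 2 (deriv φ) 0 := hφ.derivWithin (by norm_num)
    exact h1.continuousAt.tendsto.mono_left nhdsWithin_le_nhds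
  have hlim : Tendsto (fun x => d * |slope φ 0 x| ^ (d - 1) * |deriv φ x|) (𝓝[≠] 0)
      (𝓝 (d * |deriv φ 0| ^ (d - 1) * |deriv φ 0|)) :=
    ((hslope.abs.rpow_const (Or.inr (by linarith))).const_mul d).mul hcont.abs
  refine hlim.congr' ?_
  have hdiff : ∀ᶠ x in 𝓝 (0 : ℝ), DifferentiableAt ℝ φ x :=
    (hφ.eventually (by simp)).mono fun x hx => hx.differentiableAt (by norm_num)
  have hI : ∀ᶠ x in 𝓝 (0 : ℝ), I₀ ∈ 𝓝 x :=
    eventually_mem_nhds_iff.2 (Icc_mem_nhds (by norm_num) (by norm_num))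
  filter_upwards [nhdsWithin_le_nhds he.eventually_nhds, nhdsWithin_le_nhds hdiff,
    nhdsWithin_le_nhds hI, self_mem_nhdsWithin] with x hx hdx hIx hx0
  have hx0' : x ≠ 0 := hx0
  have h1 : HasDerivAt (fun t => f 0 - |φ t| ^ d) (-(d * |φ x| ^ (d - 2) * φ x * deriv φ x)) x :=
    ((hasDerivAt_abs_rpow (φ x) hd).comp x hdx.hasDerivAt).const_sub (f 0)
  have h2 : derivWithin f I₀ x = -(d * |φ x| ^ (d - 2) * φ x * deriv φ x) := by
    rw [derivWithin_of_mem_nhds hIx]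
    exact (h1.congr_of_eventuallyEq hx).deriv
  have h3 : |φ x| ^ (d - 2) * |φ x| = |φ x| ^ (d - 1) := by
    rcases eq_or_ne (φ x) 0 with h | h
    · rw [h, abs_zero, mul_zero, Real.zero_rpow (by linarith)]
    · rw [← Real.rpow_add_one (abs_ne_zero.2 h)]
      congr 1
      ring
  rw [h2, abs_neg, abs_mul, abs_mul, abs_mul, abs_of_pos (zero_lt_one.trans hd),
    abs_of_nonneg (Real.rpow_nonneg (abs_nonneg _) _), mul_assoc d (_ ^ _) |φ x|, h3, slope_def_field, hφ0,
    sub_zero, sub_zero, abs_div, Real.div_rpow (abs_nonneg _) (abs_nonneg _)]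
  ring

/-- A non-flat unimodal map satisfies `|Df(x)| ≍ |x|^α` on the whole interval, for some `α > 0`. -/
lemma NonFlat.exists_derivWithin_bounds (hf : IsUnimodal f) (h : NonFlat f) :
    ∃ α : ℝ, 0 < α ∧ ∃ c : ℝ, 1 ≤ c ∧ ∀ x ∈ I₀,
      |x| ^ α ≤ c * |derivWithin f I₀ x| ∧ |derivWithin f I₀ x| ≤ c * |x| ^ α := by
  obtain ⟨α, hα, l, hl, hlim⟩ := h.exists_tendsto
  -- the ratio `|Df(x)| / |x|^α`, extended by its limit at `0`, is continuous and positive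
  set r : ℝ → ℝ := Function.update (fun x => |derivWithin f I₀ x| / |x| ^ α) 0 l with hr
  have hcont : ContinuousOn r I₀ := by
    rw [hr, continuousOn_update_iff]
    refine ⟨?_, fun _ => hlim.mono_left (nhdsWithin_mono _ fun x hx => hx.2)⟩
    refine ((hf.continuousOn_derivWithin.mono sdiff_subset).abs).div ?_ ?_
    · exact (continuous_abs.rpow_const fun _ => Or.inr hα.le).continuousOn
    · intro x hx
      exact (Real.rpow_pos_of_pos (abs_pos.2 hx.2) α).ne'
  have hrne : ∀ x, x ≠ 0 → r x = |derivWithin f I₀ x| / |x| ^ α := fun x hx => by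
    rw [hr, Function.update_of_ne hx]
  have hpos : ∀ x ∈ I₀, 0 < r x := by
    intro x hx
    by_cases h0 : x = 0
    · rw [h0, hr, Function.update_self]; exact hl
    · rw [hrne x h0]
      exact div_pos (abs_pos.2 fun h => h0 ((hf.deriv_eq_zero_iff x hx).1 h))
        (Real.rpow_pos_of_pos (abs_pos.2 h0) α)
  have hne : I₀.Nonempty := ⟨0, by simp⟩
  obtain ⟨u, hu, humin⟩ := isCompact_Icc.exists_isMinOn hne hcont
  obtain ⟨v, hv, hvmax⟩ := isCompact_Icc.exists_isMaxOn hne hcont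
  refine ⟨α, hα, max 1 (max (r u)⁻¹ (r v)), le_max_left _ _, fun x hx => ?_⟩
  set c := max 1 (max (r u)⁻¹ (r v))
  have hc1 : (r u)⁻¹ ≤ c := (le_max_left _ _).trans (le_max_right _ _)
  have hc2 : r v ≤ c := (le_max_right _ _).trans (le_max_right _ _)
  by_cases h0 : x = 0
  · subst h0
    rw [(hf.deriv_eq_zero_iff 0 hx).2 rfl, abs_zero, Real.zero_rpow hα.ne', mul_zero]
    exact ⟨le_rfl, le_rfl⟩
  · have hxα := Real.rpow_pos_of_pos (abs_pos.2 h0) α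
    have hD : |derivWithin f I₀ x| = r x * |x| ^ α := by
      rw [hrne x h0, div_mul_cancel₀ _ hxα.ne']
    have h1 : r u ≤ r x := humin hx
    have h2 : r x ≤ r v := hvmax hx
    have hu0 := hpos u hu
    rw [hD]
    constructor
    · have : 1 ≤ c * r x := by
        calc (1 : ℝ) = (r u)⁻¹ * r u := (inv_mul_cancel₀ hu0.ne').symm
          _ ≤ c * r x := by gcongr
      nlinarith
    · gcongr
      exact h2.trans hc2

end

/-! ### Summability of the logarithmic ratios -/

section

variable {f : ℝ → ℝ}

/-- A renormalizable unimodal map `g` satisfies `g(1) ≤ 0`. Otherwise `g` maps `[0, 1]` into itself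
monotonically, which forces the period `p` to be odd and then makes `g^(p-1)(J)` overlap `J`. -/
lemma IsRenormalizationPeriod.map_one_nonpos {p : ℕ} (h : IsRenormalizationPeriod f p)
    (hf : IsUnimodal f) : f 1 ≤ 0 := by
  by_contra hcon
  have h1 : 0 < f 1 := not_le.1 hcon
  have hc := h.isCycle hf
  have hmono : ∀ n, (Even n → StrictMonoOn f^[n] (Icc 0 1)) ∧
      (Odd n → StrictAntiOn f^[n] (Icc 0 1)) := by
    have hmaps : MapsTo f (Icc 0 1) (Icc 0 1) := fun x hx =>
      ⟨h1.le.trans (hf.strictAntiOn.antitoneOn hx (by simp) hx.2),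
        (hf.mapsTo (mem_I₀.2 (by rw [abs_of_nonneg hx.1]; exact hx.2))).2⟩
    intro n
    induction n with
    | zero => exact ⟨fun _ => strictMonoOn_id, fun h => absurd h (by simp)⟩
    | succ n ih =>
      rw [Function.iterate_succ]
      refine ⟨fun he => ?_, fun ho => ?_⟩
      · have hn : Odd n := by simpa [parity_simps] using he
        exact (ih.2 hn).comp hf.strictAntiOn hmaps
      · have hn : Even n := by simpa [parity_simps] using ho
        exact (ih.1 hn).comp_strictAntiOn hf.strictAntiOn hmaps
  have hpos : ∀ n, 0 < n → ∀ x ∈ Icc (0 : ℝ) 1, 0 < f^[n] x := by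
    intro n hn
    induction n, hn using Nat.le_induction with
    | base => exact fun x hx => h1.trans_le (hf.strictAntiOn.antitoneOn hx (by simp) hx.2)
    | succ n hn ih =>
      intro x hx
      rw [Function.iterate_succ_apply']
      have hx' : x ∈ I₀ := ⟨by linarith [hx.1], hx.2⟩
      exact h1.trans_le (hf.strictAntiOn.antitoneOn ⟨(ih x hx).le, (hf.mapsTo_iterate n hx').2⟩
        (by simp) (hf.mapsTo_iterate n hx').2)
  have h0 : (0 : ℝ) ∈ Icc (0 : ℝ) 1 := by simp
  set t := f^[p] 0 with ht
  have ht0 : 0 < t := hpos p hc.pos 0 h0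
  have htmem : t ∈ Icc (0 : ℝ) 1 := ⟨ht0.le, (hf.iterate_zero_mem p).2⟩
  have hJ : ∀ x, 0 ≤ x → x ≤ t → x ∈ symmInterval f p := fun x hx hxt =>
    mem_symmInterval.2 (by rw [← ht, abs_of_nonneg hx, abs_of_pos ht0]; exact hxt)
  have htp : f^[p] t < t := by
    have := h.unimodal.strictAntiOn h0 (show (1 : ℝ) ∈ Icc (0 : ℝ) 1 by simp) one_pos
    simp only [rescale, mul_one, mul_zero, ← ht] at this
    exact lt_of_mul_lt_mul_left this (inv_pos.2 ht0).le
  have hodd : Odd p := by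
    by_contra hev
    exact absurd ((hmono p).1 (Nat.not_odd_iff_even.1 hev) h0 htmem ht0) (not_lt.2 htp.le)
  obtain ⟨m, rfl⟩ : ∃ m, p = m + 1 := ⟨p - 1, by have := hc.pos; omega⟩
  have hm : Even m := by simpa [parity_simps] using hodd
  have hm0 : 0 < m := by have := h.one_lt; omega
  have hft : f t ∈ Icc (0 : ℝ) 1 :=
    ⟨(hpos 1 one_pos t htmem).le, (hf.mapsTo (hf.iterate_zero_mem _)).2⟩
  have hle : t ≤ f t := by
    by_contra hlt
    have hlt := not_le.1 hlt
    have hs := hc.subsingleton 1 h.one_lt 0 hc.pos one_ne_zero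
    rw [orbitInterval_zero] at hs
    have hm1 : f t ∈ orbitInterval f (m + 1) 1 := ⟨t, hJ t ht0.le le_rfl, rfl⟩
    have hm2 : f 0 ∈ orbitInterval f (m + 1) 1 := ⟨0, hJ 0 le_rfl ht0.le, rfl⟩
    have hm3 : t ∈ orbitInterval f (m + 1) 1 :=
      (hf.ordConnected_orbitInterval _ _).out hm1 hm2 ⟨hlt.le, by rw [hf.map_zero]; exact htmem.2⟩
    exact hlt.ne (hs ⟨hm1, hJ _ hft.1 hlt.le⟩ ⟨hm3, hJ t ht0.le le_rfl⟩)
  have h2 : f^[m] t < t := by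
    refine lt_of_le_of_lt ?_ htp
    rw [Function.iterate_succ_apply]
    exact ((hmono m).1 hm).monotoneOn htmem hft hle
  have h3 : f^[m] 0 < f^[m] t := (hmono m).1 hm h0 htmem ht0
  have hs := hc.subsingleton m (Nat.lt_succ_self m) 0 hc.pos hm0.ne'
  rw [orbitInterval_zero] at hs
  exact h3.ne (hs ⟨⟨0, hJ 0 le_rfl ht0.le, rfl⟩, hJ _ (hpos m hm0 0 h0).le (h3.trans h2).le⟩
    ⟨⟨t, hJ t ht0.le le_rfl, rfl⟩, hJ _ (hpos m hm0 t htmem).le h2.le⟩)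

/-- The return map expands the pair `{0, λ_n}`. -/
lemma InfinitelyRenormalizable.abs_scale_le (hf : InfinitelyRenormalizable f) (n : ℕ) :
    |f^[returnTime f n] 0| ≤
      |f^[returnTime f n] 0 - f^[returnTime f n] (f^[returnTime f n] 0)| := by
  have hc := hf.isCycle n
  have h := (hf.isRenormalizationPeriod_rescale n).map_one_nonpos hc.unimodal
  have h1 := mul_iterate_rescale hc.scale_ne_zero 1 1
  rw [mul_one, mul_one, Function.iterate_one] at h1
  rw [← h1]
  set t := f^[returnTime f n] 0
  have : t - t * rescale f (returnTime f n) 1 = t * (1 - rescale f (returnTime f n) 1) := by ring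
  rw [this, abs_mul]
  exact le_mul_of_one_le_right (abs_nonneg _) (le_abs.2 (Or.inl (by linarith)))

/-- Growth of a pair of points of the central interval along the cycle, for a map with
`|Df(x)| ≤ c |x|^α`, when `r i` bounds `|x|` on the `i`-th interval. -/
lemma IsUnimodal.abs_iterate_sub_le (hf : IsUnimodal f) {c α : ℝ} (hα : 0 < α)
    (hc : 0 ≤ c) (hD : ∀ x ∈ I₀, |derivWithin f I₀ x| ≤ c * |x| ^ α) {q : ℕ} {r : ℕ → ℝ}
    (hr : ∀ i, ∀ x ∈ orbitInterval f q i, |x| ≤ r i) {x y : ℝ} (hx : x ∈ symmInterval f q)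
    (hy : y ∈ symmInterval f q) (i : ℕ) :
    |f^[i] x - f^[i] y| ≤ (∏ j ∈ Finset.range i, c * r j ^ α) * |x - y| := by
  induction i with
  | zero => simp
  | succ i ih =>
    have hA := hf.ordConnected_orbitInterval q i
    have hxi : f^[i] x ∈ orbitInterval f q i := ⟨x, hx, rfl⟩
    have hyi : f^[i] y ∈ orbitInterval f q i := ⟨y, hy, rfl⟩
    have hsub := hf.orbitInterval_subset q i
    have hr0 : 0 ≤ r i := (abs_nonneg _).trans (hr i _ hxi)
    have h := Convex.norm_image_sub_le_of_norm_hasDerivWithin_le (C := c * r i ^ α)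
      (fun z hz => (hf.hasDerivWithinAt (hsub hz)).mono hsub)
      (fun z hz => (hD z (hsub hz)).trans (by
        have := Real.rpow_le_rpow (abs_nonneg z) (hr i z hz) hα.le
        gcongr)) hA.convex hyi hxi
    rw [Real.norm_eq_abs, Real.norm_eq_abs] at h
    rw [Function.iterate_succ_apply', Function.iterate_succ_apply', Finset.prod_range_succ,
      mul_comm (∏ j ∈ Finset.range i, c * r j ^ α), mul_assoc]
    refine h.trans ?_
    gcongr

lemma le_mul_card_filter_dvd {m q : ℕ} (hm : 0 < m) (h : m ∣ q) :
    q ≤ m * ((Finset.range q).filter (m ∣ ·)).card := by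
  obtain ⟨p, rfl⟩ := h
  refine Nat.mul_le_mul_left m ?_
  conv_lhs => rw [← Finset.card_range p]
  refine Finset.card_le_card_of_injOn (fun s => m * s) (fun s hs => ?_)
    (fun s _ t _ hst => Nat.eq_of_mul_eq_mul_left hm hst)
  simp only [Finset.coe_range, mem_Iio] at hs
  simpa using Nat.mul_lt_mul_of_pos_left hs hm

/-- The `i`-th interval of level `n` lies in `Δ_{0,k+1}` for the largest `k < n` such that `q_{k+1}`
divides `i`, and the sum in the exponent is then at most `log (1 / |λ_{k+1}|)`. -/
lemma InfinitelyRenormalizable.abs_le_exp (hf : InfinitelyRenormalizable f) (n i : ℕ) :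
    ∀ x ∈ orbitInterval f (returnTime f n) i,
      |x| ≤ Real.exp
        (-∑ k ∈ Finset.range n, if returnTime f (k + 1) ∣ i then logRatio f k else 0) := by
  intro x hx
  have h : ∀ m ≤ n, |x| ≤
      Real.exp (-∑ k ∈ Finset.range m, if returnTime f (k + 1) ∣ i then logRatio f k else 0) := by
    intro m hm
    induction m with
    | zero => simpa using mem_I₀.1 (hf.1.orbitInterval_subset _ _ hx)
    | succ m ih =>
      by_cases hd : returnTime f (m + 1) ∣ i
      · have hxm := mem_centralInterval.1 (hf.orbitInterval_subset_centralInterval hm hd hx)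
        refine hxm.trans ?_
        rw [← Real.log_le_iff_le_exp (hf.abs_scale_pos _), le_neg, ← sum_logRatio hf]
        refine Finset.sum_le_sum fun k _ => ?_
        split_ifs
        · exact le_rfl
        · exact logRatio_nonneg hf k
      · rw [Finset.sum_range_succ, if_neg hd, add_zero]
        exact ih (by omega)
  exact h n le_rfl

/-- During the `q_n` steps of one period, the distance between the orbits of `0` and `λ_n` grows at
most by `c |λ_{k+1}|^α` at a passage through `Δ_{0,k+1}`, and there are `q_n / q_{k+1}` such
passages. As the distance has not decreased in the end, the total contraction of these passages is
compensated by the `q_n` factors `c`. Taking logarithms and dividing by `q_n` gives the claim. -/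
lemma InfinitelyRenormalizable.sum_logRatio_div_le (hf : InfinitelyRenormalizable f) {c α : ℝ}
    (hα : 0 < α) (hc : 1 ≤ c) (hD : ∀ x ∈ I₀, |derivWithin f I₀ x| ≤ c * |x| ^ α) (n : ℕ) :
    ∑ k ∈ Finset.range n, 1 / (returnTime f (k + 1) : ℝ) * logRatio f k ≤ Real.log c / α := by
  have hcpos : 0 < c := by linarith
  set q := returnTime f n with hq
  have hqpos : (0 : ℝ) < q := by exact_mod_cast (hf.isCycle n).pos
  set S : ℕ → ℝ := fun i =>
    ∑ k ∈ Finset.range n, if returnTime f (k + 1) ∣ i then logRatio f k else 0 with hS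
  have h1 := hf.1.abs_iterate_sub_le hα hcpos.le hD (hf.abs_le_exp n)
    (zero_mem_symmInterval f q) (mem_symmInterval.2 le_rfl) q
  rw [zero_sub, abs_neg] at h1
  have h2 : 1 ≤ ∏ i ∈ Finset.range q, c * Real.exp (-S i) ^ α :=
    le_of_mul_le_mul_right (by rw [one_mul]; exact (hf.abs_scale_le n).trans h1) (hf.abs_scale_pos n)
  have h3 : ∏ i ∈ Finset.range q, c * Real.exp (-S i) ^ α =
      Real.exp (∑ i ∈ Finset.range q, (Real.log c - α * S i)) := by
    rw [Real.exp_sum]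
    refine Finset.prod_congr rfl fun i _ => ?_
    rw [← Real.exp_mul, sub_eq_add_neg, Real.exp_add, Real.exp_log hcpos]
    congr 2
    ring
  rw [h3, Real.one_le_exp_iff, Finset.sum_sub_distrib, ← Finset.mul_sum, Finset.sum_const,
    Finset.card_range, nsmul_eq_mul] at h2
  have h4 : q * ∑ k ∈ Finset.range n, 1 / (returnTime f (k + 1) : ℝ) * logRatio f k ≤
      ∑ i ∈ Finset.range q, S i := by
    rw [hS, Finset.sum_comm, Finset.mul_sum]
    refine Finset.sum_le_sum fun k hk => ?_
    rw [← Finset.sum_filter, Finset.sum_const, nsmul_eq_mul, ← mul_assoc]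
    refine mul_le_mul_of_nonneg_right ?_ (logRatio_nonneg hf k)
    have hm := (hf.isCycle (k + 1)).pos
    have hcard := le_mul_card_filter_dvd hm
      (returnTime_dvd f (Nat.succ_le_of_lt (Finset.mem_range.1 hk)))
    rw [mul_one_div, div_le_iff₀ (by exact_mod_cast hm), mul_comm]
    exact_mod_cast hcard
  rw [le_div_iff₀ hα]
  have h5 : q * ((∑ k ∈ Finset.range n, 1 / (returnTime f (k + 1) : ℝ) * logRatio f k) * α) ≤
      q * Real.log c := by nlinarith
  exact le_of_mul_le_mul_left h5 hqpos

/-- The series `∑ (1 / q_{n+1}) log (|Δ_{0,n}| / |Δ_{0,n+1}|)` always converges. -/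
lemma InfinitelyRenormalizable.summable_logRatio_div (hf : InfinitelyRenormalizable f)
    (hflat : NonFlat f) :
    Summable fun n => 1 / (returnTime f (n + 1) : ℝ) * logRatio f n := by
  obtain ⟨α, hα, c, hc, hD⟩ := hflat.exists_derivWithin_bounds hf.1
  exact summable_of_sum_range_le
    (fun n => mul_nonneg (by positivity) (logRatio_nonneg hf n))
    (hf.sum_logRatio_div_le hα hc fun x hx => (hD x hx).2)

end

/-! ### An interval on which `|Df| ≠ 1` -/

section

variable {f : ℝ → ℝ}

/-- The noncentral intervals of a cycle stay outside the interior of the central one. -/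
lemma IsCycle.abs_scale_le_abs {q : ℕ} (hc : IsCycle f q) (hf : IsUnimodal f) {i : ℕ} (hi : i < q)
    (hi0 : i ≠ 0) {x : ℝ} (hx : x ∈ orbitInterval f q i) : |f^[q] 0| ≤ |x| := by
  by_contra hlt
  have hlt := abs_lt.1 (not_le.1 hlt)
  have hs := hc.subsingleton i hi 0 hc.pos hi0
  obtain ⟨a, b, hab, he⟩ := hc.exists_eq_Icc hf hi
  rw [orbitInterval_zero, he, symmInterval] at hs
  rw [he] at hx
  have hxm : x ∈ Icc a b ∩ Icc (-|f^[q] 0|) |f^[q] 0| := ⟨hx, hlt.1.le, hlt.2.le⟩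
  rcases hx.2.lt_or_eq with h | h
  · have h1 : x < min b |f^[q] 0| := lt_min h hlt.2
    exact h1.ne (hs hxm ⟨⟨hx.1.trans h1.le, min_le_left _ _⟩, hlt.1.le.trans h1.le,
      min_le_right _ _⟩)
  · have h1 : max a (-|f^[q] 0|) < x := max_lt (h ▸ hab) hlt.1
    exact h1.ne' (hs hxm ⟨⟨le_max_left _ _, h1.le.trans hx.2⟩, le_max_right _ _,
      h1.le.trans hlt.2.le⟩)

/-- Some interval of some cycle contains no point with `|Df| = 1`. Otherwise `λ_n` does not tend to
`0`, since `Df(0) = 0`. Hence the noncentral intervals stay away from the critical point, where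
`log |Df|` is Lipschitz. As it vanishes somewhere in each of them and their total length is bounded,
lengths decrease along the cycle by at most a bounded factor. All the `q_n - 1` noncentral intervals
of level `n` then have a length bounded below independently of `n`, which is absurd. -/
lemma InfinitelyRenormalizable.exists_orbitInterval_abs_derivWithin_ne_one
    (hf : InfinitelyRenormalizable f) :
    ∃ n, ∃ i < returnTime f n, ∀ x ∈ orbitInterval f (returnTime f n) i,
      |derivWithin f I₀ x| ≠ 1 := by
  by_contra! H
  obtain ⟨K, hK⟩ := hf.1.exists_lipschitzOnWith_derivWithin
  have hlip : ∀ x ∈ I₀, ∀ y ∈ I₀, |derivWithin f I₀ x - derivWithin f I₀ y| ≤ K * |x - y| :=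
    fun x hx y hy => by simpa [Real.dist_eq] using hK.dist_le_mul x hx y hy
  have hD0 : derivWithin f I₀ 0 = 0 := (hf.1.deriv_eq_zero_iff 0 (by simp)).2 rfl
  have hlam : ∀ n, 1 ≤ K * |f^[returnTime f n] 0| := by
    intro n
    obtain ⟨x, hx, hx1⟩ := H n 0 (hf.isCycle n).pos
    rw [orbitInterval_zero] at hx
    have h := hlip x (hf.1.symmInterval_subset _ hx) 0 (by simp)
    rw [hD0, sub_zero, sub_zero, hx1] at h
    exact h.trans (mul_le_mul_of_nonneg_left (mem_symmInterval.1 hx) K.coe_nonneg)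
  have hKpos : (0 : ℝ) < K := by
    have := hlam 0
    rw [hf.abs_scale_zero] at this
    linarith
  set δ : ℝ := 1 / K with hδ
  have hδpos : 0 < δ := by positivity
  have hδle : ∀ n, δ ≤ |f^[returnTime f n] 0| := fun n => by
    rw [hδ, div_le_iff₀' hKpos]; exact hlam n
  have hδ1 : δ ≤ 1 := (hδle 0).trans hf.abs_scale_zero.le
  -- a lower bound for `|Df|` away from the critical point
  obtain ⟨m, hm, hmD⟩ : ∃ m : ℝ, 0 < m ∧ ∀ x ∈ I₀, δ ≤ |x| → m ≤ |derivWithin f I₀ x| := by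
    have hcpt : IsCompact (I₀ ∩ {x : ℝ | δ ≤ |x|}) :=
      isCompact_Icc.inter_right (isClosed_le continuous_const continuous_abs)
    obtain ⟨u, hu, hmin⟩ := hcpt.exists_isMinOn ⟨1, by simp, by simpa using hδ1⟩
      (hf.1.continuousOn_derivWithin.abs.mono inter_subset_left)
    refine ⟨_, abs_pos.2 fun h => ?_, fun x hx hxδ => hmin ⟨hx, hxδ⟩⟩
    have h0 := (hf.1.deriv_eq_zero_iff u hu.1).1 h
    have hu2 : δ ≤ |u| := hu.2
    rw [h0, abs_zero] at hu2
    linarith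
  set κ := K / m with hκ
  have hκpos : 0 < κ := by positivity
  have hstep : ∀ n i, i ≠ 0 → i + 1 < returnTime f n →
      Real.exp (-(κ * volume.real (orbitInterval f (returnTime f n) i))) *
        volume.real (orbitInterval f (returnTime f n) i) ≤
      volume.real (orbitInterval f (returnTime f n) (i + 1)) := by
    intro n i hi0 hi
    have hc := hf.isCycle n
    obtain ⟨a, b, hab, he⟩ := hc.exists_eq_Icc hf.1 (Nat.lt_of_succ_lt hi)
    obtain ⟨a', b', hab', he'⟩ := hc.exists_eq_Icc hf.1 hi
    have hsub := hf.1.orbitInterval_subset (returnTime f n) i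
    have hfar : ∀ x ∈ Icc a b, δ ≤ |x| := fun x hx =>
      (hδle n).trans (hc.abs_scale_le_abs hf.1 (Nat.lt_of_succ_lt hi) hi0 (he ▸ hx))
    have hmaps : MapsTo f (Icc a b) (Icc a' b') := by
      intro x hx
      rw [← he', add_comm, ← image_orbitInterval, he]
      exact mem_image_of_mem _ hx
    obtain ⟨y, hy, hy1⟩ := H n i (Nat.lt_of_succ_lt hi)
    rw [he] at hsub hy ⊢
    rw [he', Real.volume_real_Icc_of_le hab.le, Real.volume_real_Icc_of_le hab'.le]
    obtain ⟨z, hz, hzs⟩ := exists_hasDerivAt_eq_slope f (derivWithin f I₀) hab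
      (hf.1.continuousOn.mono hsub) fun x hx =>
        (hf.1.hasDerivWithinAt (hsub (Ioo_subset_Icc_self hx))).hasDerivAt
          (Filter.mem_of_superset (Icc_mem_nhds hx.1 hx.2) hsub)
    have hzI := Ioo_subset_Icc_self hz
    have hba : 0 < b - a := sub_pos.2 hab
    have hexp : Real.exp (-(κ * (b - a))) ≤ |derivWithin f I₀ z| := by
      have hmz := hmD z (hsub hzI) (hfar z hzI)
      have hzpos : 0 < |derivWithin f I₀ z| := hm.trans_le hmz
      rw [← Real.le_log_iff_exp_le hzpos]
      rcases le_total 1 |derivWithin f I₀ z| with h1 | h1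
      · exact (neg_nonpos.2 (by positivity)).trans (Real.log_nonneg h1)
      · have h2 : 1 - |derivWithin f I₀ z| ≤ K * (b - a) := by
          have h3 := hlip y (hsub hy) z (hsub hzI)
          have h4 := abs_sub_abs_le_abs_sub (derivWithin f I₀ y) (derivWithin f I₀ z)
          have h5 : |y - z| ≤ b - a :=
            abs_le.2 ⟨by linarith [hy.1, hzI.2], by linarith [hy.2, hzI.1]⟩
          rw [hy1] at h4
          exact (h4.trans h3).trans (by gcongr)
        calc -(κ * (b - a)) = -(K * (b - a) / m) := by rw [hκ]; ring
          _ ≤ -((1 - |derivWithin f I₀ z|) / |derivWithin f I₀ z|) := by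
            gcongr
          _ = 1 - |derivWithin f I₀ z|⁻¹ := by field_simp; ring
          _ ≤ _ := Real.one_sub_inv_le_log_of_pos hzpos
    have hfa := hmaps (left_mem_Icc.2 hab.le)
    have hfb := hmaps (right_mem_Icc.2 hab.le)
    calc Real.exp (-(κ * (b - a))) * (b - a) ≤ |derivWithin f I₀ z| * (b - a) := by gcongr
      _ = |f b - f a| := by
          rw [hzs, abs_div, abs_of_pos hba, div_mul_cancel₀ _ hba.ne']
      _ ≤ b' - a' := abs_le.2 ⟨by linarith [hfb.1, hfa.2], by linarith [hfb.2, hfa.1]⟩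
  set η := f 0 - f δ with hη
  have hηpos : 0 < η :=
    sub_pos.2 (hf.1.strictAntiOn (by simp) ⟨hδpos.le, hδ1⟩ hδpos)
  have hone : ∀ n, 1 < returnTime f n →
      η ≤ volume.real (orbitInterval f (returnTime f n) 1) := by
    intro n hn
    obtain ⟨a, b, hab, he⟩ := (hf.isCycle n).exists_eq_Icc hf.1 hn
    have h0 : f 0 ∈ Icc a b := he ▸ ⟨0, zero_mem_symmInterval _ _, rfl⟩
    have h1 : f δ ∈ Icc a b :=
      he ▸ ⟨δ, mem_symmInterval.2 (by rw [abs_of_pos hδpos]; exact hδle n), rfl⟩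
    rw [he, Real.volume_real_Icc_of_le hab.le]
    linarith [h0.2, h1.1]
  have hall : ∀ n j, j + 1 < returnTime f n →
      Real.exp (-(κ * 4)) * η ≤ volume.real (orbitInterval f (returnTime f n) (j + 1)) := by
    intro n j hj
    set v : ℕ → ℝ := fun i => volume.real (orbitInterval f (returnTime f n) i) with hv
    have hv0 : ∀ i, 0 ≤ v i := fun i => measureReal_nonneg
    have hind : Real.exp (-(κ * ∑ i ∈ Finset.range (j + 1), v i)) * η ≤ v (j + 1) := by
      induction j with
      | zero =>
        refine le_trans ?_ (hone n hj)
        refine mul_le_of_le_one_left hηpos.le (Real.exp_le_one_iff.2 (neg_nonpos.2 ?_))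
        exact mul_nonneg hκpos.le (Finset.sum_nonneg fun i _ => hv0 i)
      | succ j ih =>
        refine le_trans ?_ (hstep n (j + 1) j.succ_ne_zero hj)
        rw [Finset.sum_range_succ, mul_add, neg_add_rev, Real.exp_add, mul_assoc]
        exact mul_le_mul_of_nonneg_left (ih (Nat.lt_of_succ_lt hj)) (Real.exp_pos _).le
    refine le_trans ?_ hind
    have hsum : ∑ i ∈ Finset.range (j + 1), v i ≤ 4 :=
      (Finset.sum_le_sum_of_subset_of_nonneg (Finset.range_mono hj.le) fun i _ _ => hv0 i).trans
        ((hf.isCycle n).sum_length_le hf.1)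
    gcongr
  obtain ⟨n, hn⟩ := exists_nat_gt (4 / (Real.exp (-(κ * 4)) * η))
  rw [div_lt_iff₀ (by positivity)] at hn
  have hq : n + 1 ≤ returnTime f n := Nat.lt_two_pow_self.trans_le (hf.two_pow_le_returnTime n)
  have h4 := (hf.isCycle n).sum_length_le hf.1
  have h5 : ∑ j ∈ Finset.range n, Real.exp (-(κ * 4)) * η ≤
      ∑ i ∈ Finset.range (returnTime f n), volume.real (orbitInterval f (returnTime f n) i) := by
    calc _ ≤ ∑ j ∈ Finset.range n, volume.real (orbitInterval f (returnTime f n) (j + 1)) :=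
          Finset.sum_le_sum fun j hj => hall n j (by have := Finset.mem_range.1 hj; omega)
      _ ≤ ∑ i ∈ Finset.range (n + 1), volume.real (orbitInterval f (returnTime f n) i) := by
          rw [Finset.sum_range_succ']
          exact le_add_of_nonneg_right measureReal_nonneg
      _ ≤ _ := Finset.sum_le_sum_of_subset_of_nonneg (Finset.range_mono hq)
          fun i _ _ => measureReal_nonneg
  rw [Finset.sum_const, Finset.card_range, nsmul_eq_mul] at h5
  linarith

end

/-! ### The integral of `|log |Df||` -/

section

variable {f : ℝ → ℝ}

/-- A lower bound for the integral, uniform in the measure. -/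
lemma InfinitelyRenormalizable.exists_le_lintegral (hf : InfinitelyRenormalizable f) :
    ∃ e : ℝ, 0 < e ∧ ∀ μ : Measure ℝ, IsPostcriticalMeasure f μ →
      ENNReal.ofReal e ≤ ∫⁻ x in I₀, ENNReal.ofReal |logAbsDeriv f x| ∂μ := by
  obtain ⟨n, i, hi, hne⟩ := hf.exists_orbitInterval_abs_derivWithin_ne_one
  have hc := hf.isCycle n
  set q := returnTime f n
  have hcpt := hf.1.isCompact_orbitInterval q i
  have hsub := hf.1.orbitInterval_subset q i
  obtain ⟨u, hu, hmin⟩ := hcpt.exists_isMinOn (hf.1.isConnected_orbitInterval q i).nonempty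
    (((hf.1.continuousOn_derivWithin.mono hsub).abs.sub continuousOn_const).abs :
      ContinuousOn (fun x => |(|derivWithin f I₀ x| - 1)|) _)
  set ε := |(|derivWithin f I₀ u| - 1)| with hε
  have hεpos : 0 < ε := abs_pos.2 (sub_ne_zero.2 (hne u hu))
  set e := min ε (Real.log (1 + ε)) with he
  have hepos : 0 < e := lt_min hεpos (Real.log_pos (by linarith))
  have hle : ∀ x ∈ orbitInterval f q i \ {0}, e ≤ |logAbsDeriv f x| := by
    intro x hx
    have hxε : ε ≤ |(|derivWithin f I₀ x| - 1)| := hmin hx.1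
    have hpos : 0 < |derivWithin f I₀ x| :=
      abs_pos.2 fun h => hx.2 ((hf.1.deriv_eq_zero_iff x (hsub hx.1)).1 h)
    rw [logAbsDeriv]
    rcases le_abs.1 hxε with h | h
    · refine (min_le_right _ _).trans (le_trans ?_ (le_abs_self _))
      exact Real.log_le_log (by linarith) (by linarith)
    · refine (min_le_left _ _).trans (le_trans ?_ (neg_le_abs _))
      linarith [Real.log_le_sub_one_of_pos hpos]
  have hqpos : (0 : ℝ) < q := by exact_mod_cast hc.pos
  refine ⟨e / q, by positivity, fun μ hμ => ?_⟩
  calc ENNReal.ofReal (e / q) = ENNReal.ofReal e * (q : ENNReal)⁻¹ := by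
        rw [ENNReal.ofReal_div_of_pos hqpos, ENNReal.ofReal_natCast, div_eq_mul_inv]
    _ ≤ ENNReal.ofReal e * μ (orbitInterval f q i) := by
        rw [hμ.measure_orbitInterval hf.1 hc hi]
        gcongr
        exact hμ.inv_le_measure hf.1 hc
    _ = ∫⁻ _ in orbitInterval f q i \ {0}, ENNReal.ofReal e ∂μ := by
        rw [setLIntegral_const, measure_sdiff_null (hμ.measure_zero hf)]
    _ ≤ ∫⁻ x in orbitInterval f q i \ {0}, ENNReal.ofReal |logAbsDeriv f x| ∂μ :=
        setLIntegral_mono' (hcpt.measurableSet.diff (measurableSet_singleton 0))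
          fun x hx => ENNReal.ofReal_le_ofReal (hle x hx)
    _ ≤ _ := lintegral_mono_set (sdiff_subset.trans hsub)

lemma abs_logAbsDeriv_le (hf : IsUnimodal f) {c α : ℝ} (hα : 0 < α) (hc : 1 ≤ c) {x : ℝ}
    (hx : x ∈ I₀) (hx0 : x ≠ 0)
    (hD : |x| ^ α ≤ c * |derivWithin f I₀ x| ∧ |derivWithin f I₀ x| ≤ c * |x| ^ α) :
    |logAbsDeriv f x| ≤ Real.log c + α * -Real.log |x| := by
  have hcpos : 0 < c := by linarith
  have hxpos : 0 < |x| := abs_pos.2 hx0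
  have hpos : 0 < |derivWithin f I₀ x| :=
    abs_pos.2 fun h => hx0 ((hf.deriv_eq_zero_iff x hx).1 h)
  have h1 := Real.log_le_log (Real.rpow_pos_of_pos hxpos α) hD.1
  have h2 := Real.log_le_log hpos hD.2
  rw [Real.log_mul hcpos.ne' hpos.ne', Real.log_rpow hxpos] at h1
  rw [Real.log_mul hcpos.ne' (Real.rpow_pos_of_pos hxpos α).ne', Real.log_rpow hxpos] at h2
  have h3 : α * Real.log |x| ≤ 0 :=
    mul_nonpos_of_nonneg_of_nonpos hα.le (Real.log_nonpos hxpos.le (mem_I₀.1 hx))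
  rw [logAbsDeriv, abs_le]
  constructor <;> linarith

/-- Outside the null set `⋂ Δ_{0,n}`, the value `log (1 / |x|)` is at most the sum of the logarithmic
ratios over all the levels `n` with `x ∈ Δ_{0,n}`. -/
lemma InfinitelyRenormalizable.ofReal_neg_log_le (hf : InfinitelyRenormalizable f) {x : ℝ}
    (hx : x ∈ I₀) (hx' : x ∉ ⋂ n, centralInterval f n) :
    ENNReal.ofReal (-Real.log |x|) ≤
      ∑' n, (centralInterval f n).indicator (fun _ => ENNReal.ofReal (logRatio f n)) x := by
  classical
  have hex : ∃ n, x ∉ centralInterval f n := by simpa using hx'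
  have h0 : x ∈ centralInterval f 0 := by
    rw [mem_centralInterval, hf.abs_scale_zero]; exact mem_I₀.1 hx
  obtain ⟨n, hn⟩ : ∃ n, Nat.find hex = n + 1 := by
    refine Nat.exists_eq_succ_of_ne_zero fun h => ?_
    have := Nat.find_spec hex
    rw [h] at this
    exact this h0
  have hout := Nat.find_spec hex
  rw [hn, mem_centralInterval, not_le] at hout
  have hin : ∀ k ∈ Finset.range (n + 1), x ∈ centralInterval f k := fun k hk =>
    not_not.1 (Nat.find_min hex (hn ▸ Finset.mem_range.1 hk))
  calc ENNReal.ofReal (-Real.log |x|)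
      ≤ ENNReal.ofReal (∑ k ∈ Finset.range (n + 1), logRatio f k) := by
        rw [sum_logRatio hf]
        exact ENNReal.ofReal_le_ofReal
          (neg_le_neg (Real.log_le_log (hf.abs_scale_pos _) hout.le))
    _ = ∑ k ∈ Finset.range (n + 1),
          (centralInterval f k).indicator (fun _ => ENNReal.ofReal (logRatio f k)) x := by
        rw [ENNReal.ofReal_sum_of_nonneg fun k _ => logRatio_nonneg hf k]
        exact Finset.sum_congr rfl fun k hk => by rw [indicator_of_mem (hin k hk)]
    _ ≤ _ := ENNReal.sum_le_tsum _

lemma InfinitelyRenormalizable.exists_lintegral_le (hf : InfinitelyRenormalizable f)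
    (hflat : NonFlat f) :
    ∃ C : ℝ, 0 ≤ C ∧ ∀ μ : Measure ℝ, IsPostcriticalMeasure f μ →
      ∫⁻ x in I₀, ENNReal.ofReal |logAbsDeriv f x| ∂μ ≤ ENNReal.ofReal C *
        ∑' n, ENNReal.ofReal (1 / (returnTime f n : ℝ) * logRatio f n) := by
  obtain ⟨α, hα, c, hc, hD⟩ := hflat.exists_derivWithin_bounds hf.1
  have hlogc : 0 ≤ Real.log c := Real.log_nonneg hc
  have hl0 := logRatio_zero_pos hf
  -- the first term of the series absorbs the additive constant `log c`
  refine ⟨Real.log c / logRatio f 0 + α * 2, by positivity, fun μ hμ => ?_⟩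
  have hprob := hμ.isProbabilityMeasure
  set T := ∑' n, ENNReal.ofReal (1 / (returnTime f n : ℝ) * logRatio f n) with hT
  have hmeas : ∀ n, MeasurableSet (centralInterval f n) := fun n => measurableSet_Icc
  have hpt : ∀ᵐ x ∂μ.restrict I₀, ENNReal.ofReal |logAbsDeriv f x| ≤
      ENNReal.ofReal (Real.log c) + ENNReal.ofReal α *
        ∑' n, (centralInterval f n).indicator (fun _ => ENNReal.ofReal (logRatio f n)) x := by
    have hnull : ∀ᵐ x ∂μ, x ∉ ⋂ n, centralInterval f n :=
      measure_eq_zero_iff_ae_notMem.1 (hμ.measure_iInter_centralInterval hf)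
    filter_upwards [ae_restrict_of_ae hnull, ae_restrict_mem measurableSet_Icc] with x hx hxI
    have hx0 : x ≠ 0 := by
      rintro rfl
      exact hx (mem_iInter.2 fun n => zero_mem_symmInterval f _)
    refine (ENNReal.ofReal_le_ofReal (abs_logAbsDeriv_le hf.1 hα hc hxI hx0 (hD x hxI))).trans ?_
    refine ENNReal.ofReal_add_le.trans ?_
    rw [ENNReal.ofReal_mul hα.le]
    gcongr
    exact hf.ofReal_neg_log_le hxI hx
  have hterm : ∀ n, ENNReal.ofReal (logRatio f n) * μ (centralInterval f n) ≤
      2 * ENNReal.ofReal (1 / (returnTime f n : ℝ) * logRatio f n) := by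
    intro n
    have hq : (0 : ℝ) < returnTime f n := by exact_mod_cast (hf.isCycle n).pos
    calc _ ≤ ENNReal.ofReal (logRatio f n) * (2 / (returnTime f n : ENNReal)) := by
          gcongr
          exact hμ.measure_le_two_div hf.1 (hf.isCycle n)
      _ = _ := by
          rw [ENNReal.ofReal_mul (by positivity), one_div, ENNReal.ofReal_inv_of_pos hq,
            ENNReal.ofReal_natCast, div_eq_mul_inv]
          ring
  have hfirst : ENNReal.ofReal (logRatio f 0) ≤ T := by
    have h := ENNReal.le_tsum
      (f := fun n => ENNReal.ofReal (1 / (returnTime f n : ℝ) * logRatio f n)) 0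
    beta_reduce at h
    rwa [returnTime_zero, Nat.cast_one, one_div_one, one_mul] at h
  calc ∫⁻ x in I₀, ENNReal.ofReal |logAbsDeriv f x| ∂μ
      ≤ ∫⁻ x in I₀, (ENNReal.ofReal (Real.log c) + ENNReal.ofReal α *
        ∑' n, (centralInterval f n).indicator (fun _ => ENNReal.ofReal (logRatio f n)) x) ∂μ :=
        lintegral_mono_ae hpt
    _ ≤ ∫⁻ x, (ENNReal.ofReal (Real.log c) + ENNReal.ofReal α *
        ∑' n, (centralInterval f n).indicator (fun _ => ENNReal.ofReal (logRatio f n)) x) ∂μ :=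
        setLIntegral_le_lintegral _ _
    _ = ENNReal.ofReal (Real.log c) + ENNReal.ofReal α *
        ∑' n, ENNReal.ofReal (logRatio f n) * μ (centralInterval f n) := by
        rw [lintegral_add_left measurable_const, lintegral_const, measure_univ, mul_one,
          lintegral_const_mul' _ _ ENNReal.ofReal_ne_top,
          lintegral_tsum fun n => (measurable_const.indicator (hmeas n)).aemeasurable]
        simp_rw [lintegral_indicator_const (hmeas _)]
    _ ≤ ENNReal.ofReal (Real.log c / logRatio f 0) * T + ENNReal.ofReal α * (2 * T) := by
        refine add_le_add ?_ (mul_le_mul_right (?_) _)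
        · calc ENNReal.ofReal (Real.log c)
              = ENNReal.ofReal (Real.log c / logRatio f 0) * ENNReal.ofReal (logRatio f 0) := by
                rw [← ENNReal.ofReal_mul (by positivity), div_mul_cancel₀ _ hl0.ne']
            _ ≤ _ := by gcongr
        · rw [hT, ← ENNReal.tsum_mul_left]
          exact ENNReal.tsum_le_tsum hterm
    _ = ENNReal.ofReal (Real.log c / logRatio f 0 + α * 2) * T := by
        rw [ENNReal.ofReal_add (by positivity) (by positivity), ENNReal.ofReal_mul hα.le,
          ENNReal.ofReal_ofNat]
        ring

lemma InfinitelyRenormalizable.summable_of_boundedType (hf : InfinitelyRenormalizable f)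
    (hflat : NonFlat f) (hb : BoundedType f) :
    Summable fun n => 1 / (returnTime f n : ℝ) * logRatio f n := by
  obtain ⟨B, hB⟩ := hb
  refine Summable.of_nonneg_of_le
    (fun n => mul_nonneg (by positivity) (logRatio_nonneg hf n)) (fun n => ?_)
    ((hf.summable_logRatio_div hflat).mul_left (B : ℝ))
  rw [← mul_assoc]
  refine mul_le_mul_of_nonneg_right ?_ (logRatio_nonneg hf n)
  have h1 : (0 : ℝ) < returnTime f n := by exact_mod_cast (hf.isCycle n).pos
  have h2 : (0 : ℝ) < returnTime f (n + 1) := by exact_mod_cast (hf.isCycle (n + 1)).pos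
  rw [mul_one_div, div_le_div_iff₀ h1 h2, one_mul, mul_comm, returnTime_succ]
  push_cast
  gcongr
  exact hB n

lemma IsUnimodal.aestronglyMeasurable_logAbsDeriv (hf : IsUnimodal f) (μ : Measure ℝ) :
    AEStronglyMeasurable (logAbsDeriv f) (μ.restrict I₀) :=
  (Real.measurable_log.comp_aemeasurable
    (hf.continuousOn_derivWithin.abs.aemeasurable measurableSet_Icc)).aestronglyMeasurable

end

end Unimodal

theorem mainTheorem7 (f : ℝ → ℝ) (hf : Unimodal.InfinitelyRenormalizable f)
    (hflat : Unimodal.NonFlat f) :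
    (∃ C : ℝ, 1 < C ∧ ∀ μ : MeasureTheory.Measure ℝ, Unimodal.IsPostcriticalMeasure f μ →
      ENNReal.ofReal (1 / C) *
          (∑' n : ℕ, ENNReal.ofReal
            (1 / (Unimodal.returnTime f (n + 1) : ℝ) * Unimodal.logRatio f n)) ≤
        (∫⁻ x in Set.Icc (-1 : ℝ) 1, ENNReal.ofReal |Unimodal.logAbsDeriv f x| ∂μ) ∧
      (∫⁻ x in Set.Icc (-1 : ℝ) 1, ENNReal.ofReal |Unimodal.logAbsDeriv f x| ∂μ) ≤
        ENNReal.ofReal C *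
          (∑' n : ℕ, ENNReal.ofReal
            (1 / (Unimodal.returnTime f n : ℝ) * Unimodal.logRatio f n))) ∧
    (Unimodal.BoundedType f →
      Summable (fun n : ℕ => 1 / (Unimodal.returnTime f n : ℝ) * Unimodal.logRatio f n) ∧
      ∀ μ : MeasureTheory.Measure ℝ, Unimodal.IsPostcriticalMeasure f μ →
        MeasureTheory.IntegrableOn (Unimodal.logAbsDeriv f) (Set.Icc (-1) 1) μ) := by
  obtain ⟨C, hC, hup⟩ := hf.exists_lintegral_le hflat
  refine ⟨?_, fun hb => ?_⟩
  · obtain ⟨e, he, hlow⟩ := hf.exists_le_lintegral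
    have hnn : ∀ n, 0 ≤ 1 / (Unimodal.returnTime f (n + 1) : ℝ) * Unimodal.logRatio f n :=
      fun n => mul_nonneg (by positivity) (Unimodal.logRatio_nonneg hf n)
    set S := ∑' n, 1 / (Unimodal.returnTime f (n + 1) : ℝ) * Unimodal.logRatio f n with hS
    have hS0 : 0 ≤ S := tsum_nonneg hnn
    have hSe : 0 ≤ S / e := by positivity
    refine ⟨2 + C + S / e, by linarith, fun μ hμ => ⟨?_, ?_⟩⟩
    · refine le_trans ?_ (hlow μ hμ)
      rw [← ENNReal.ofReal_tsum_of_nonneg hnn (hf.summable_logRatio_div hflat), ← hS,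
        ← ENNReal.ofReal_mul (by positivity)]
      refine ENNReal.ofReal_le_ofReal ?_
      rw [one_div_mul_eq_div, div_le_iff₀ (by positivity), ← div_le_iff₀' he]
      linarith
    · refine (hup μ hμ).trans ?_
      gcongr
      linarith
  · have hsum := hf.summable_of_boundedType hflat hb
    refine ⟨hsum, fun μ hμ => ⟨hf.1.aestronglyMeasurable_logAbsDeriv μ, ?_⟩⟩
    rw [hasFiniteIntegral_iff_norm]
    refine lt_of_le_of_lt (hup μ hμ) (ENNReal.mul_lt_top ENNReal.ofReal_lt_top ?_)
    exact hsum.tsum_ofReal_lt_top
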